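/- Let $T$ be a complete first-order theory in a language $\mathcal L$ and let $\mathfrak C$ be a monster model of $T$, i.e. a $\bar\kappa$-saturated and strongly $\bar\kappa$-homogeneous model for a cardinal $\bar\kappa > |T| := |\mathcal L| + \aleph_0$. "Small" means of cardinality $<\bar\kappa$. For small $A, A', B$ write $A' \equiv_B A$ if there is a partial elementary map that fixes $B$ pointwise and maps $A$ onto $A'$. An *independence relation* on $\mathfrak C$ is a ternary relation $A \perp_C B$ on small subsets of $\mathfrak C$ such that, for all small $A,B,C,D$: (Invariance) $A\perp_C B$ implies $\sigma(A)\perp_{\sigma(C)}\sigma(B)$ for $\sigma\in\mathrm{Aut}(\mathfrak C)$; (Normality) $A\perp_C B$ implies $A\cup C\perp_C B$; (Symmetry) $A\perp_C B$ implies $B\perp_C A$; (Transitivity) if $B\subseteq C\subseteq D$, then $A\perp_B D$ iff $A\perp_B C$ and $A\perp_C D$; (Finite character) $A\perp_C B$ iff $A_0\perp_C B$ for all finite $A_0\subseteq A$; (Extension) there is $A'\equiv_C A$ with $A'\perp_C B$; (Local character) there is a small cardinal $\kappa_0$, depending only on $\perp$, such that for all small $A, C$ there is $C_0\subseteq C$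 with $|C_0|<\kappa_0+|A|^+$ and $A\perp_{C_0}C$. For arbitrary $A,B,C\subseteq\mathfrak C$, $A\perp_C B$ means: for all small $A'\subseteq A$, $B'\subseteq B$, $C'\subseteq C$ there is a small $C''$ with $C'\subseteq C''\subseteq C$ and $A'\perp_{C''}B'$. The closure operator of $\perp$ is $\mathrm{cl}(X)=\{c : c\perp_X c\}$, for $X \subseteq \mathfrak C$. The constant $\kappa_0(\perp)$ is the smallest regular cardinal $\mu$ such that for every finite $A$ and small $B$ there is $B_0\subseteq B$ with $|B_0|<\mu$ and $A\perp_{B_0}B$. The relation $\perp$ satisfies (*) if, for all finite tuples $a \in \mathfrak C^k$, $b \in \mathfrak C^h$ and every (not necessarily small) $C \subseteq \mathfrak C$ with $a\not\perp_C b$, there are a finite tuple $c$ from $C$, of length $l$, and a formula $\phi(x,y,z)$ such that $\phi(a,b,c)$ holds and, for all $a' \in \mathfrak C^k$ and all tuples $c'$ from $C$ of length $l$, $\phi(a',b,c')$ implies $a'\not\perp_C b$. Fix an independence relation $\perp$ on $\mathfrak C$ and a small cardinal $\kappa>\max(\kappa_0(\perp),|T|)$. Let $\mathcal L^2=\mathcal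 L\cup\{P\}$ with $P$ a new unary predicate. For $M\preceq\mathfrak C$ and $P(M)\subseteq M$, the pair $\langle M,P(M)\rangle$ is *lovely* if, for every $A\subseteq M$ with $|A|<\kappa$ and every $b\in\mathfrak C$: (Density) if $b\perp_{P(M)\cap A}A$, then some $b'\in P(M)$ has $b'\equiv_A b$; (Extension) some $b'\in M$ has $b'\equiv_A b$ and $b'\perp_A P(M)$. Let $T^d$ be the $\mathcal L^2$-theory of all lovely pairs $\langle M,P(M)\rangle$ with $M$ small. Assume that loveliness is first-order, i.e. for some small $\lambda$ every $\lambda$-saturated model $\langle M,P(M)\rangle$ of $T^d$ with $M\preceq\mathfrak C$ is lovely. Let $P\subseteq\mathfrak C$ be such that $\mathfrak C_P=\langle\mathfrak C,P\rangle$ is a monster model of $T^d$ (with the same $\bar\kappa$), and define $A\perp^P_C B :\iff A\perp_{C\cup P}B$ for $A,B,C\subseteq\mathfrak C$. Then: 1. $\perp^P$ (restricted to small sets) is an independence relation on $\mathfrak C_P$ (with automorphisms and elementary maps in the sense of $\mathcal L^2$), and its extension from small sets to arbitrary sets described above is again given by $A\perp_{C\cup P}B$. 2. The local character constant is the same for $\perp^P$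 and $\perp$: a cardinal $\kappa_0$ witnesses Local character for $\perp^P$ iff it does so for $\perp$, and $\kappa_0(\perp^P)=\kappa_0(\perp)$. 3. The closure operator $\mathrm{cl}_P$ of $\perp^P$ satisfies $\mathrm{cl}_P(X)=\mathrm{cl}(X\cup P)$ for all $X\subseteq\mathfrak C$; in particular, $\mathrm{cl}_P(\emptyset)=P$. 4. If $\perp$ satisfies (*) (with $\mathcal L$-formulas), then $\perp^P$ satisfies (*) (with $\mathcal L^2$-formulas). -/

import Mathlib

open scoped FirstOrder Cardinal

universe u v w

namespace Lovely

section General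

variable (L : FirstOrder.Language.{u, v}) {M : Type w} [L.Structure M]

/-- `f` preserves the truth of all `L`-formulas on tuples from `S` (a partial elementary map). -/
def IsElementaryOn (f : M → M) (S : Set M) : Prop :=
  ∀ (n : ℕ) (φ : L.Formula (Fin n)) (x : Fin n → M), (∀ i, x i ∈ S) →
    (φ.Realize (f ∘ x) ↔ φ.Realize x)

/-- `A' ≡_B A`: some partial elementary map fixes `B` pointwise and maps `A` onto `A'`. -/
def SameType (B A' A : Set M) : Prop :=
  ∃ f : M → M, IsElementaryOn L f (A ∪ B) ∧ (∀ b ∈ B, f b = b) ∧ f '' A = A'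

variable (M) in
/-- `κ`-saturation: every finitely satisfiable set of formulas in one variable, with parameters
from a set of cardinality less than `κ`, is realized. -/
def IsSaturated (κ : Cardinal.{w}) : Prop :=
  ∀ A : Set M, #A < κ → ∀ Γ : Set (L[[A]].Formula Unit),
    (∀ Δ ⊆ Γ, Δ.Finite → ∃ x : M, ∀ φ ∈ Δ, φ.Realize (fun _ => x)) →
    ∃ x : M, ∀ φ ∈ Γ, φ.Realize (fun _ => x)

variable (M) in
/-- Strong `κ`-homogeneity. -/
def IsStronglyHomogeneous (κ : Cardinal.{w}) : Prop :=
  ∀ A : Set M, #A < κ → ∀ f : M → M, IsElementaryOn L f A →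
    ∃ σ : M ≃[L] M, ∀ a ∈ A, σ a = f a

/-- `|T| = max (ℵ₀, |L|)` is less than `κ`. -/
def CardTheoryLT (κ : Cardinal.{w}) : Prop :=
  ℵ₀ < κ ∧ Cardinal.lift.{w} L.card < Cardinal.lift.{max u v} κ

variable {L} in
variable (M) in
/-- `M` is a monster model of `T`, of monstrosity `κbar`. -/
structure IsMonsterModel (T : L.Theory) (κbar : Cardinal.{w}) : Prop where
  model : M ⊨ T
  card_lt : CardTheoryLT L κbar
  saturated : IsSaturated L M κbar
  homogeneous : IsStronglyHomogeneous L M κbar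

end General

section Independence

/-! A ternary relation `ind` is read as: `ind A C B` iff `A` is independent from `B` over `C`.
Only its values on small sets matter (small: of cardinality less than `κbar`). -/

variable {M : Type w} (κbar : Cardinal.{w}) (ind : Set M → Set M → Set M → Prop)

/-- The extension of a relation on small sets to arbitrary sets. -/
def ExtInd (A C B : Set M) : Prop :=
  ∀ A' ⊆ A, ∀ C' ⊆ C, ∀ B' ⊆ B, #A' < κbar → #C' < κbar → #B' < κbar →
    ∃ C'' : Set M, C' ⊆ C'' ∧ C'' ⊆ C ∧ #C'' < κbar ∧ ind A' C'' B'

/-- Local character with constant `κ₀`. -/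
def LocalCharacter (κ₀ : Cardinal.{w}) : Prop :=
  ∀ A C : Set M, #A < κbar → #C < κbar →
    ∃ C₀ ⊆ C, #C₀ < κ₀ + Order.succ #A ∧ ind A C₀ C

/-- Symmetric independence relations (on the small subsets of an `L`-structure). -/
structure IsIndependenceRelation (L : FirstOrder.Language.{u, v}) [L.Structure M] : Prop where
  invariance : ∀ A B C : Set M, #A < κbar → #B < κbar → #C < κbar →
    ∀ σ : M ≃[L] M, ind A C B → ind (σ '' A) (σ '' C) (σ '' B)
  normality : ∀ A B C : Set M, #A < κbar → #B < κbar → #C < κbar →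
    ind A C B → ind (A ∪ C) C B
  symmetry : ∀ A B C : Set M, #A < κbar → #B < κbar → #C < κbar →
    ind A C B → ind B C A
  transitivity : ∀ A B C D : Set M, #A < κbar → #B < κbar → #C < κbar → #D < κbar →
    B ⊆ C → C ⊆ D → (ind A B D ↔ ind A B C ∧ ind A C D)
  finite_character : ∀ A B C : Set M, #A < κbar → #B < κbar → #C < κbar →
    (ind A C B ↔ ∀ A₀ ⊆ A, A₀.Finite → ind A₀ C B)
  extension : ∀ A B C : Set M, #A < κbar → #B < κbar → #C < κbar →
    ∃ A' : Set M, SameType L C A' A ∧ ind A' C B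
  local_character : ∃ κ₀ < κbar, LocalCharacter κbar ind κ₀

/-- The constant `κ₀` of `ind`: the smallest regular cardinal `κ` such that for every finite tuple
`a` and every small `B` there is `B₀ ⊆ B` with `|B₀| < κ` and `a` independent from `B` over `B₀`. -/
noncomputable def kappaZero : Cardinal.{w} :=
  sInf {κ : Cardinal.{w} | κ.IsRegular ∧ ∀ A B : Set M, A.Finite → #B < κbar →
    ∃ B₀ ⊆ B, #B₀ < κ ∧ ind A B₀ B}

/-- The closure operator induced by `ind`. -/
def closureOp (X : Set M) : Set M :=
  {c | ExtInd κbar ind {c} X {c}}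

/-- Property (*). -/
def PropertyStar (L : FirstOrder.Language.{u, v}) [L.Structure M] : Prop :=
  ∀ (k h : ℕ) (a : Fin k → M) (b : Fin h → M) (C : Set M),
    ¬ ExtInd κbar ind (Set.range a) C (Set.range b) →
    ∃ (l : ℕ) (c : Fin l → M) (φ : L.Formula (Fin k ⊕ Fin h ⊕ Fin l)),
      (∀ i, c i ∈ C) ∧ φ.Realize (Sum.elim a (Sum.elim b c)) ∧
      ∀ (a' : Fin k → M) (c' : Fin l → M), (∀ i, c' i ∈ C) →
        φ.Realize (Sum.elim a' (Sum.elim b c')) →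
        ¬ ExtInd κbar ind (Set.range a') C (Set.range b)

/-- The relation `ind_P`: `A` is independent from `B` over `C ∪ P`. -/
def indP (P : Set M) : Set M → Set M → Set M → Prop :=
  fun A C B => ExtInd κbar ind A (C ∪ P) B

end Independence

section Pairs

/-- The only symbol of the language of one predicate. -/
inductive PredRel : ℕ → Type
  | mem : PredRel 1

/-- The language with one unary predicate symbol. -/
def predLanguage : FirstOrder.Language.{0, 0} := ⟨fun _ => Empty, PredRel⟩

/-- `L²`, the language `L` with a new unary predicate symbol. -/
def pairLanguage (L : FirstOrder.Language.{u, v}) : FirstOrder.Language.{u, v} := L.sum predLanguage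

/-- The structure for the new predicate, interpreted as `P`. -/
abbrev predStructure {M : Type w} (P : Set M) : predLanguage.Structure M where
  funMap := fun f => nomatch f
  RelMap := fun r x => match r, x with
    | PredRel.mem, x => x 0 ∈ P

/-- The `L²`-structure `⟨M, P⟩`. -/
abbrev pairStructure (L : FirstOrder.Language.{u, v}) {M : Type w} [L.Structure M] (P : Set M) :
    (pairLanguage L).Structure M :=
  letI := predStructure P
  L.sumStructure predLanguage M

variable {L : FirstOrder.Language.{u, v}} {M : Type w} [L.Structure M]
  (κbar κ : Cardinal.{w}) (ind : Set M → Set M → Set M → Prop)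

/-- For `N ≼ M` and `Q ⊆ N`, the pair `⟨N, Q⟩` as an `L²`-structure. -/
abbrev subpairStructure (N : L.ElementarySubstructure M) (Q : Set M) :
    (pairLanguage L).Structure N :=
  pairStructure L ((fun x : N => (x : M)) ⁻¹' Q)

/-- Density property of `⟨N, Q⟩`, for very small (fewer than `κ` elements) parameter sets.
Complete types over `A` are given by their realizations in the monster model `M`. -/
def HasDensity (N : L.ElementarySubstructure M) (Q : Set M) : Prop :=
  ∀ A : Set M, A ⊆ N → #A < κ → ∀ b : M, ind {b} (Q ∩ A) A →
    ∃ b' ∈ Q, SameType L A {b'} {b}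

/-- Extension property of `⟨N, Q⟩`, for very small parameter sets. -/
def HasExtension (N : L.ElementarySubstructure M) (Q : Set M) : Prop :=
  ∀ A : Set M, A ⊆ N → #A < κ → ∀ b : M,
    ∃ b' ∈ N, SameType L A {b'} {b} ∧ ExtInd κbar ind {b'} A Q

/-- `⟨N, Q⟩` is a (`κ`-)lovely pair, except that `N ≼ M` need not be small. -/
structure IsLovely (N : L.ElementarySubstructure M) (Q : Set M) : Prop where
  subset : Q ⊆ N
  density : HasDensity κ ind N Q
  extension : HasExtension κbar κ ind N Q

/-- `T^d`, the theory of (small, `κ`-)lovely pairs. -/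
def lovelyTheory : (pairLanguage L).Theory :=
  {φ | ∀ (N : L.ElementarySubstructure M) (Q : Set M), #N < κbar → IsLovely κbar κ ind N Q →
    letI := subpairStructure N Q
    (N : Type w) ⊨ φ}

/-- Loveliness is first-order: every sufficiently saturated model of `T^d` is lovely. (As always,
models of `T` are regarded as elementary substructures of the monster model `M`; the monster model
itself is one of them.) -/
def LovelinessIsFirstOrder : Prop :=
  ∃ lam < κbar, ∀ (N : L.ElementarySubstructure M) (Q : Set M), Q ⊆ N →
    letI := subpairStructure N Q
    (N : Type w) ⊨ lovelyTheory (L := L) κbar κ ind → IsSaturated (pairLanguage L) N lam →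
      IsLovely κbar κ ind N Q

end Pairs

end Lovely

/-!
Over a monster model, types over a small set are orbits of automorphisms that fix it pointwise, so
everything is phrased with automorphisms `σ : M ≃[L] M` instead of partial elementary maps.

The relation `ExtInd` is defined through small sets, but it obeys the rules of an independence
relation on arbitrary sets. The reason is local character over large sets: a finite set is
independent from any set `C` over a subset of `C` with fewer than `kappaZero` elements
(`IsIndependenceRelation.exists_base_of_finite`); otherwise a chain of length `kappaZero`, which is
regular and small, would have a small union that contradicts the definition of `kappaZero`.
`GlobalIndependence` records the resulting calculus. Apart from Extension, the axioms for
independence over `P` and the description of its own extension to arbitrary sets follow from it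
formally. For (*), the parameters in `P` are quantified out by an `L²`-formula.

By loveliness, `M` realizes in `P` each type over a set `A` with fewer than `κ` elements that is
independent from `A` over `P ∩ A`, and every type over `A` has a realization independent from `P`
over `A`. The first property gives that the closure of `P` is `P` (`LovelyUnderAut.mem_of_self`). Both together
give a back-and-forth between sets `E` that are independent from `P` over a subset of `P ∩ E`, so
that an automorphism of `M` that maps such a set to another one, respecting `P`, preserves the
`L²`-types of its tuples (`LovelyUnderAut.isElementaryOn_of_pairIso`).

The extension property, known for sets with fewer than `κ` elements, extends to all small sets
(`LovelyUnderAut.extension_of_small`): independence from `P` over fewer than `κ` elements determines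
the `L²`-type, these types cohere, and `⟨M, P⟩` is saturated. This gives Extension for independence
over `P`: fix a base of `A ∪ C` in `P`, make `A` independent from `B` over `C` and this base, and
then from `P`; the resulting map is elementary in `L²` by back-and-forth. It also gives each small
set a conjugate that is independent from `P` over the empty set. Between subsets of such a
conjugate, independence over `C ∪ P` implies independence over `C` whenever `C` is also a subset of
it, and so local character for independence over `P` gives local character for the original
relation, with the same bound.
-/

namespace Lovely

/-! ### Small sets and the calculus of an independence relation on them -/

section SmallSets

variable {α : Type w} {θ : Cardinal.{w}}

theorem mk_union_lt (h0 : ℵ₀ ≤ θ) {A B : Set α} (hA : #A < θ) (hB : #B < θ) :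
    #(A ∪ B : Set α) < θ :=
  (Cardinal.mk_union_le A B).trans_lt (Cardinal.add_lt_of_lt h0 hA hB)

theorem mk_lt_of_subset {A B : Set α} (h : A ⊆ B) (hB : #B < θ) : #A < θ :=
  (Cardinal.mk_le_mk_of_subset h).trans_lt hB

theorem mk_image_lt {A : Set α} (f : α → α) (hA : #A < θ) : #(f '' A) < θ :=
  Cardinal.mk_image_le.trans_lt hA

theorem mk_lt_of_finite (h0 : ℵ₀ ≤ θ) {A : Set α} (hA : A.Finite) : #A < θ :=
  (Cardinal.lt_aleph0_iff_set_finite.2 hA).trans_le h0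

/-- A union of sets smaller than `ν`, indexed by the finite subsets of `A`. -/
theorem mk_iUnion_finset_lt {ν : Cardinal.{w}} (h0 : ℵ₀ < θ) (hν : ν < θ) {A : Set α}
    (hA : #A < θ) (f : Finset A → Set α) (hf : ∀ s, #(f s) < ν) : #(⋃ s, f s) < θ := by
  refine (Cardinal.mk_iUnion_le f).trans_lt (Cardinal.mul_lt_of_lt h0.le ?_ ?_)
  · rcases finite_or_infinite A with h | h
    · exact (Cardinal.lt_aleph0_of_finite _).trans h0
    · rwa [Cardinal.mk_finset_of_infinite]
  · exact (ciSup_le' fun s => (hf s).le).trans_lt hν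

end SmallSets

section SmallCalculus

variable {L : FirstOrder.Language.{u, v}} {M : Type w} [L.Structure M] {κbar : Cardinal.{w}}
  {ind : Set M → Set M → Set M → Prop} {A A' B B' C D : Set M}

theorem SameType.exists_aut (hom : IsStronglyHomogeneous L M κbar) (h0 : ℵ₀ ≤ κbar)
    (hA : #A < κbar) (hC : #C < κbar) (h : SameType L C A' A) :
    ∃ σ : M ≃[L] M, (∀ c ∈ C, σ c = c) ∧ σ '' A = A' := by
  obtain ⟨f, hf, hfC, rfl⟩ := h
  obtain ⟨σ, hσ⟩ := hom _ (mk_union_lt h0 hA hC) f hf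
  exact ⟨σ, fun c hc => (hσ c (.inr hc)).trans (hfC c hc),
    Set.image_congr fun a ha => hσ a (.inl ha)⟩

theorem image_eq_self_of_fix {f : M → M} (h : ∀ c ∈ C, f c = c) : f '' C = C := by
  rw [Set.image_congr h, Set.image_id']

namespace IsIndependenceRelation

variable (hind : IsIndependenceRelation κbar ind L)
include hind

theorem mono_left (hA : #A < κbar) (hB : #B < κbar) (hC : #C < κbar) (h : ind A C B)
    (hA' : A' ⊆ A) : ind A' C B :=
  (hind.finite_character A' B C (mk_lt_of_subset hA' hA) hB hC).2 fun F hF hfin =>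
    (hind.finite_character A B C hA hB hC).1 h F (hF.trans hA') hfin

theorem mono_right (hA : #A < κbar) (hB : #B < κbar) (hC : #C < κbar) (h : ind A C B)
    (hB' : B' ⊆ B) : ind A C B' :=
  hind.symmetry _ _ _ (mk_lt_of_subset hB' hB) hA hC <|
    hind.mono_left hB hA hC (hind.symmetry _ _ _ hA hB hC h) hB'

theorem normality_right (h0 : ℵ₀ ≤ κbar) (hA : #A < κbar) (hB : #B < κbar) (hC : #C < κbar)
    (h : ind A C B) : ind A C (B ∪ C) :=
  hind.symmetry _ _ _ (mk_union_lt h0 hB hC) hA hC <|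
    hind.normality _ _ _ hB hA hC (hind.symmetry _ _ _ hA hB hC h)

/-- Extension, with the new realization of the type given by an automorphism. -/
theorem exists_aut (hom : IsStronglyHomogeneous L M κbar) (h0 : ℵ₀ ≤ κbar)
    (hA : #A < κbar) (hB : #B < κbar) (hC : #C < κbar) :
    ∃ σ : M ≃[L] M, (∀ c ∈ C, σ c = c) ∧ ind (σ '' A) C B := by
  obtain ⟨A', hA', h⟩ := hind.extension A B C hA hB hC
  obtain ⟨σ, hσ, rfl⟩ := hA'.exists_aut hom h0 hA hC
  exact ⟨σ, hσ, h⟩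

theorem self (hom : IsStronglyHomogeneous L M κbar) (h0 : ℵ₀ ≤ κbar)
    (hA : #A < κbar) (hC : #C < κbar) : ind A C C := by
  obtain ⟨σ, hσ, h⟩ := hind.exists_aut hom h0 hA hC hC
  have h' := hind.invariance _ _ _ (mk_image_lt σ hA) hC hC σ.symm h
  have hfix : ∀ c ∈ C, σ.symm c = c := fun c hc => by
    rw [← hσ c hc, σ.symm_apply_apply, hσ c hc]
  rw [image_eq_self_of_fix hfix, Set.image_image] at h'
  simpa using h'

/-- The cardinal `kappaZero` is regular and has the property that defines it. -/
theorem kappaZero_spec (h0 : ℵ₀ ≤ κbar) :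
    (kappaZero κbar ind).IsRegular ∧ ∀ A B : Set M, A.Finite → #B < κbar →
    ∃ B₀ ⊆ B, #B₀ < kappaZero κbar ind ∧ ind A B₀ B := by
  refine csInf_mem (s := {κ : Cardinal.{w} | κ.IsRegular ∧ ∀ A B : Set M, A.Finite → #B < κbar →
    ∃ B₀ ⊆ B, #B₀ < κ ∧ ind A B₀ B}) ?_
  obtain ⟨κ₀, hκ₀, h⟩ := hind.local_character
  -- a regular cardinal above every bound that local character gives for finite sets
  refine ⟨Order.succ (κ₀ + ℵ₀), Cardinal.isRegular_succ le_add_self, fun A B hA hB => ?_⟩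
  obtain ⟨B₀, hB₀, hlt, hi⟩ := h A B (mk_lt_of_finite h0 hA) hB
  refine ⟨B₀, hB₀, hlt.trans_le ((add_le_add_right ?_ κ₀).trans (Order.le_succ _)), hi⟩
  exact Order.succ_le_of_lt (Cardinal.lt_aleph0_iff_set_finite.2 hA)

/-- Local character of a finite set over an arbitrarily large set. If it failed, a chain of sets of
length `kappaZero`, each of which depends on the previous ones over their union, would have a small
union that contradicts the definition of `kappaZero`. -/
theorem exists_base_of_finite (h0 : ℵ₀ ≤ κbar) (hν : kappaZero κbar ind < κbar)
    (hA : A.Finite) (C : Set M) : ∃ C₀ ⊆ C, #C₀ < kappaZero κbar ind ∧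
      ∀ D ⊆ C, #D < κbar → ind A C₀ D := by
  obtain ⟨hreg, hspec⟩ := hind.kappaZero_spec h0
  set ν := kappaZero κbar ind with hνdef
  have hAs := mk_lt_of_finite h0 hA
  by_contra! hcon
  -- the failure of independence is witnessed by a finite set
  have hF : ∀ S : Set M, ∃ T : Set M, T ⊆ C ∧ T.Finite ∧ (S ⊆ C → #S < ν → ¬ ind A S T) := by
    intro S
    by_cases hS : S ⊆ C ∧ #S < ν
    · obtain ⟨D, hDC, hD, hn⟩ := hcon S hS.1 hS.2
      have hSs := hS.2.trans hν
      have : ¬ ∀ T ⊆ D, T.Finite → ind T S A := fun h => hn <|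
        hind.symmetry _ _ _ hD hAs hSs <| (hind.finite_character D A S hD hAs hSs).2 h
      push Not at this
      obtain ⟨T, hTD, hT, hn⟩ := this
      exact ⟨T, hTD.trans hDC, hT, fun _ _ h => hn <|
        hind.symmetry _ _ _ hAs (mk_lt_of_finite h0 hT) hSs h⟩
    · exact ⟨∅, Set.empty_subset _, Set.finite_empty, fun h h' => absurd ⟨h, h'⟩ hS⟩
  choose F hFC hFfin hFind using hF
  obtain ⟨G, hG⟩ : ∃ G : ν.ord.ToType → Set M, ∀ i, G i = ⋃ j : Set.Iio i, F (G j) :=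
    ⟨wellFounded_lt.fix fun i r => ⋃ j : Set.Iio i, F (r j j.2),
      fun i => wellFounded_lt.fix_eq _ i⟩
  have hGC : ∀ i, G i ⊆ C := fun i => by
    rw [hG]; exact Set.iUnion_subset fun j => hFC _
  have hGlt : ∀ i, #(G i) < ν := fun i => by
    rw [hG]
    refine (Cardinal.card_iUnion_lt_iff_forall_of_isRegular hreg
      (by simpa using Cardinal.mk_Iio_lt i (by simp))).2 fun j =>
        mk_lt_of_finite hreg.aleph0_le (hFfin _)
  set U := ⋃ i, F (G i) with hU
  have hUs : #U < κbar := by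
    refine lt_of_le_of_lt ?_ hν
    refine (Cardinal.mk_iUnion_le _).trans (Cardinal.mul_le_of_le hreg.aleph0_le ?_ ?_)
    · simp
    · exact ciSup_le' fun i => (mk_lt_of_finite hreg.aleph0_le (hFfin _)).le
  obtain ⟨U₀, hU₀, hlt, hi⟩ := hspec A U hA hUs
  -- by regularity, `U₀` is contained in one member of the chain
  have hmem : ∀ x : U₀, ∃ i, (x : M) ∈ F (G i) := fun x => Set.mem_iUnion.1 (hU₀ x.2)
  choose f hf using hmem
  have hnc : ¬ IsCofinal (Set.range f) := fun h => by
    have h1 := (Order.cof_le h).trans Cardinal.mk_range_le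
    rw [Ordinal.cof_toType, hreg.cof_ord] at h1
    exact h1.not_gt hlt
  simp only [IsCofinal, not_forall, Set.exists_range_iff, not_exists, not_le] at hnc
  obtain ⟨k, hk⟩ := hnc
  have hsub : U₀ ⊆ G k := fun x hx => by
    rw [hG]; exact Set.mem_iUnion.2 ⟨⟨f ⟨x, hx⟩, hk ⟨x, hx⟩⟩, hf ⟨x, hx⟩⟩
  have hGU : G k ⊆ U := by
    rw [hG]; exact Set.iUnion_subset fun j => Set.subset_iUnion (fun i => F (G i)) j
  have hGs := (hGlt k).trans hν
  refine hFind _ (hGC k) (hGlt k) (hind.mono_right hAs hUs hGs ?_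
    (Set.subset_iUnion (fun i => F (G i)) k))
  exact ((hind.transitivity A U₀ (G k) U hAs (hlt.trans hν) hGs hUs hsub hGU).1 hi).2

end IsIndependenceRelation

end SmallCalculus

/-! ### Independence between arbitrary sets -/

section GlobalCalculus

variable {L : FirstOrder.Language.{u, v}} {M : Type w} [L.Structure M]

/-- An independence relation between arbitrary subsets of an `L`-structure, with local character in
the form: a finite set is independent from `C` over a subset of `C` with fewer than `ν` elements.
Extension is not part of this structure. -/
structure GlobalIndependence (L : FirstOrder.Language.{u, v}) {M : Type w} [L.Structure M]
    (I : Set M → Set M → Set M → Prop) (ν : Cardinal.{w}) : Prop where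
  invariance : ∀ {A B C : Set M} (σ : M ≃[L] M), I A C B → I (σ '' A) (σ '' C) (σ '' B)
  symm : ∀ {A B C : Set M}, I A C B → I B C A
  mono_left : ∀ {A A' B C : Set M}, A' ⊆ A → I A C B → I A' C B
  of_finite : ∀ {A B C : Set M}, (∀ F ⊆ A, F.Finite → I F C B) → I A C B
  union_left : ∀ {A B C : Set M}, I A C B → I (A ∪ C) C B
  trans : ∀ {A B C D : Set M}, B ⊆ C → C ⊆ D → I A B C → I A C D → I A B D
  base_mono : ∀ {A B C D : Set M}, B ⊆ C → C ⊆ D → I A B D → I A C D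
  local_base : ∀ {F : Set M}, F.Finite → ∀ C : Set M, ∃ C₀ ⊆ C, #C₀ < ν ∧ I F C₀ C

namespace GlobalIndependence

variable {I : Set M → Set M → Set M → Prop} {ν : Cardinal.{w}} {A A' B B' C D E : Set M}
  (hI : GlobalIndependence L I ν)
include hI

theorem mono_right (hB : B' ⊆ B) (h : I A C B) : I A C B' :=
  hI.symm (hI.mono_left hB (hI.symm h))

theorem mono (hA : A' ⊆ A) (hB : B' ⊆ B) (h : I A C B) : I A' C B' :=
  hI.mono_left hA (hI.mono_right hB h)

theorem union_right (h : I A C B) : I A C (B ∪ C) :=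
  hI.symm (hI.union_left (hI.symm h))

theorem of_finite_right (h : ∀ F ⊆ B, F.Finite → I A C F) : I A C B :=
  hI.symm (hI.of_finite fun F hF hfin => hI.symm (h F hF hfin))

/-- The base may be enlarged within `B ∪ C`. -/
theorem base_up (hCD : C ⊆ D) (hD : D ⊆ B ∪ C) (h : I A C B) : I A D B :=
  hI.mono_right Set.subset_union_left (hI.base_mono hCD hD (hI.union_right h))

/-- The base `C` may be replaced by a smaller one, over which `A` is independent from `C`. -/
theorem base_down (hDC : D ⊆ C) (h : I A D C) (h' : I A C B) : I A D B :=
  hI.mono_right Set.subset_union_left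
    (hI.trans hDC Set.subset_union_right h (hI.union_right h'))

theorem self (A C : Set M) : I A C C :=
  hI.of_finite fun F _ hF => by
    obtain ⟨C₀, hC₀, -, h⟩ := hI.local_base hF C
    exact hI.base_mono hC₀ subset_rfl h

/-- A set that is independent from itself over `C` is independent from everything over `C`. -/
theorem of_self (h : I A C A) (B : Set M) : I A C B := by
  have h1 : I A (A ∪ C) B :=
    hI.symm (hI.mono_right Set.subset_union_left (hI.self B (A ∪ C)))
  exact hI.mono_right Set.subset_union_left
    (hI.trans Set.subset_union_right Set.subset_union_right (hI.union_right h) (hI.union_right h1))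

/-- Left transitivity: `A` and then `B` are independent from `D`. -/
theorem union_of (hA : I A C D) (hB : I B (C ∪ A) D) : I (B ∪ A) C D := by
  have h1 : I D C (A ∪ C) := hI.union_right (hI.symm hA)
  have h2 : I D (A ∪ C) B := hI.symm (Set.union_comm C A ▸ hB)
  have h3 : I D C (B ∪ (A ∪ C)) :=
    hI.trans Set.subset_union_right Set.subset_union_right h1 (hI.union_right h2)
  exact hI.symm (hI.mono_right (Set.union_subset_union_right _ Set.subset_union_left) h3)

/-- Local character for a set with fewer than `θ` elements, where `ν < θ`. -/
theorem exists_base {θ : Cardinal.{w}} (h0 : ℵ₀ < θ) (hν : ν < θ) (hA : #A < θ) (C : Set M) :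
    ∃ C₀ ⊆ C, #C₀ < θ ∧ I A C₀ C := by
  choose f hfC hfν hf using fun s : Finset A =>
    hI.local_base ((s.finite_toSet).image Subtype.val) C
  refine ⟨⋃ s, f s, Set.iUnion_subset hfC, mk_iUnion_finset_lt h0 hν hA f hfν, ?_⟩
  refine hI.of_finite fun F hF hfin => ?_
  have hfin' : (Subtype.val ⁻¹' F : Set A).Finite := hfin.preimage Subtype.val_injective.injOn
  have h1 := hf hfin'.toFinset
  rw [Set.Finite.coe_toFinset, Subtype.image_preimage_coe, Set.inter_eq_right.2 hF] at h1
  exact hI.base_mono (Set.subset_iUnion f _) (Set.iUnion_subset hfC) h1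

end GlobalIndependence

end GlobalCalculus

section ExtInd

variable {L : FirstOrder.Language.{u, v}} {M : Type w} [L.Structure M] {κbar : Cardinal.{w}}
  {ind : Set M → Set M → Set M → Prop} {A A' B B' C C₀ D : Set M}

theorem ExtInd.mono (h : ExtInd κbar ind A C B) (hA : A' ⊆ A) (hB : B' ⊆ B) :
    ExtInd κbar ind A' C B' :=
  fun X hX Y hY Z hZ => h X (hX.trans hA) Y hY Z (hZ.trans hB)

namespace IsIndependenceRelation

variable (hind : IsIndependenceRelation κbar ind L)
include hind

/-- Independence over an arbitrary set `C` is independence over any small base of `A` in `C`. -/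
theorem extInd_iff_of_base (h0 : ℵ₀ ≤ κbar) (hA : #A < κbar) (hC₀ : #C₀ < κbar) (hC₀C : C₀ ⊆ C)
    (hbase : ∀ D ⊆ C, #D < κbar → ind A C₀ D) :
    ExtInd κbar ind A C B ↔ ∀ D ⊆ B ∪ C, #D < κbar → ind A C₀ D := by
  constructor
  · intro h D hD hDs
    obtain ⟨E, hE, hEC, hEs, hi⟩ := h A subset_rfl (C₀ ∪ D ∩ C)
      (Set.union_subset hC₀C Set.inter_subset_right) (D ∩ B) Set.inter_subset_right hA
      (mk_union_lt h0 hC₀ (mk_lt_of_subset Set.inter_subset_left hDs))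
      (mk_lt_of_subset Set.inter_subset_left hDs)
    have hDB : #(D ∩ B : Set M) < κbar := mk_lt_of_subset Set.inter_subset_left hDs
    have hs := mk_union_lt h0 hDB hEs
    have h1 := (hind.transitivity A C₀ E ((D ∩ B) ∪ E) hA hC₀ hEs hs
      (Set.subset_union_left.trans hE) Set.subset_union_right).2
      ⟨hbase E hEC hEs, hind.normality_right h0 hA hDB hEs hi⟩
    refine hind.mono_right hA hs hC₀ h1 fun x hx => ?_
    rcases hD hx with hB | hC
    · exact .inl ⟨hx, hB⟩
    · exact .inr (hE (.inr ⟨hx, hC⟩))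
  · intro h X hX Y hY Z hZ hXs hYs hZs
    have hCY := mk_union_lt h0 hC₀ hYs
    have hs := mk_union_lt h0 hZs hCY
    refine ⟨C₀ ∪ Y, Set.subset_union_right, Set.union_subset hC₀C hY, hCY, ?_⟩
    have h1 := h (Z ∪ (C₀ ∪ Y)) (Set.union_subset_union hZ (Set.union_subset hC₀C hY)) hs
    have h2 := ((hind.transitivity A C₀ (C₀ ∪ Y) _ hA hC₀ hCY hs Set.subset_union_left
      Set.subset_union_right).1 h1).2
    exact hind.mono_left hA hZs hCY (hind.mono_right hA hs hCY h2 Set.subset_union_left) hX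

/-- On small sets, `ExtInd` is the given relation. -/
theorem extInd_iff (hA : #A < κbar) (hB : #B < κbar) (hC : #C < κbar) :
    ExtInd κbar ind A C B ↔ ind A C B := by
  constructor
  · intro h
    obtain ⟨E, hE, hEC, -, hi⟩ := h A subset_rfl C subset_rfl B subset_rfl hA hC hB
    rwa [subset_antisymm hE hEC]
  · intro h X hX Y hY Z hZ _ _ hZs
    exact ⟨C, hY, subset_rfl, hC,
      hind.mono_left hA hZs hC (hind.mono_right hA hB hC h hZ) hX⟩

/-- The extension of an independence relation to arbitrary sets satisfies the same rules. -/
theorem globalIndependence (h0 : ℵ₀ ≤ κbar) (hν : kappaZero κbar ind < κbar) :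
    GlobalIndependence L (ExtInd κbar ind) (kappaZero κbar ind) := by
  have symm : ∀ {A B C : Set M}, ExtInd κbar ind A C B → ExtInd κbar ind B C A := by
    intro A B C h X hX Y hY Z hZ hXs hYs hZs
    obtain ⟨E, hE, hEC, hEs, hi⟩ := h Z hZ Y hY X hX hZs hYs hXs
    exact ⟨E, hE, hEC, hEs, hind.symmetry _ _ _ hZs hXs hEs hi⟩
  -- the union of the bases of the finite subsets of `X` is a base of `X`
  have base : ∀ {X : Set M}, #X < κbar → ∀ C : Set M, ∃ C₀ ⊆ C, #C₀ < κbar ∧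
      ∀ F ⊆ X, F.Finite → ∀ D ⊆ C, #D < κbar → ind F C₀ D := by
    intro X hX C
    rcases X.finite_or_infinite with hfin | hinf
    · obtain ⟨C₀, hC₀C, hC₀, h⟩ := hind.exists_base_of_finite h0 hν hfin C
      exact ⟨C₀, hC₀C, hC₀.trans hν, fun F hF _ D hD hDs =>
        hind.mono_left hX hDs (hC₀.trans hν) (h D hD hDs) hF⟩
    · have h0' : ℵ₀ < κbar := (Cardinal.infinite_iff.1 hinf.to_subtype).trans_lt hX
      choose f hfC hfν hf using fun s : Finset X =>
        hind.exists_base_of_finite h0 hν ((s.finite_toSet).image Subtype.val) C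
      have hs : #(⋃ s, f s) < κbar := mk_iUnion_finset_lt h0' hν hX f hfν
      refine ⟨⋃ s, f s, Set.iUnion_subset hfC, hs, fun F hF hfin D hD hDs => ?_⟩
      have hfin' : (Subtype.val ⁻¹' F : Set X).Finite := hfin.preimage Subtype.val_injective.injOn
      have h1 := hf hfin'.toFinset
      rw [Set.Finite.coe_toFinset, Subtype.image_preimage_coe, Set.inter_eq_right.2 hF] at h1
      have hFs := mk_lt_of_finite h0 hfin
      have hU := mk_union_lt h0 hDs hs
      have h2 := h1 (D ∪ ⋃ s, f s) (Set.union_subset hD (Set.iUnion_subset hfC)) hU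
      have h3 := ((hind.transitivity F _ (⋃ s, f s) _ hFs ((hfν _).trans hν) hs hU
        (Set.subset_iUnion f _) Set.subset_union_right).1 h2).2
      exact hind.mono_right hFs hU hs h3 Set.subset_union_left
  have of_finite : ∀ {A B C : Set M}, (∀ F ⊆ A, F.Finite → ExtInd κbar ind F C B) →
      ExtInd κbar ind A C B := by
    intro A B C h X hX Y hY Z hZ hXs hYs hZs
    obtain ⟨C₀, hC₀C, hC₀, hb⟩ := base hXs C
    have key : ExtInd κbar ind X C B := by
      refine (hind.extInd_iff_of_base h0 hXs hC₀ hC₀C fun D hD hDs =>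
        (hind.finite_character X D C₀ hXs hDs hC₀).2 fun F hF hfin => hb F hF hfin D hD hDs).2 ?_
      intro D hD hDs
      refine (hind.finite_character X D C₀ hXs hDs hC₀).2 fun F hF hfin => ?_
      exact (hind.extInd_iff_of_base h0 (mk_lt_of_finite h0 hfin) hC₀ hC₀C (hb F hF hfin)).1
        (h F (hF.trans hX) hfin) D hD hDs
    exact key X subset_rfl Y hY Z hZ hXs hYs hZs
  -- a base of `F` in `B` is also a base in `C`, if `F` is independent from `C` over `B`
  have iff_fin : ∀ {F B C D : Set M}, F.Finite → B ⊆ C → C ⊆ D → (ExtInd κbar ind F B D ↔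
      ExtInd κbar ind F B C ∧ ExtInd κbar ind F C D) := by
    intro F B C D hF hBC hCD
    have hFs := mk_lt_of_finite h0 hF
    obtain ⟨B₀, hB₀B, hB₀, hb⟩ := hind.exists_base_of_finite h0 hν hF B
    have hB₀s := hB₀.trans hν
    rw [hind.extInd_iff_of_base h0 hFs hB₀s hB₀B hb, hind.extInd_iff_of_base h0 hFs hB₀s hB₀B hb,
      Set.union_eq_left.2 (hBC.trans hCD), Set.union_eq_left.2 hBC]
    constructor
    · intro h
      have hC : ∀ E ⊆ C, #E < κbar → ind F B₀ E := fun E hE => h E (hE.trans hCD)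
      refine ⟨hC, ?_⟩
      rwa [hind.extInd_iff_of_base h0 hFs hB₀s (hB₀B.trans hBC) hC, Set.union_eq_left.2 hCD]
    · rintro ⟨hC, h⟩
      rwa [hind.extInd_iff_of_base h0 hFs hB₀s (hB₀B.trans hBC) hC, Set.union_eq_left.2 hCD] at h
  refine ⟨?_, symm, fun hA h => h.mono hA subset_rfl, of_finite, ?_, ?_, ?_, ?_⟩
  · intro A B C σ h X hX Y hY Z hZ hXs hYs hZs
    have hsub : ∀ {S S' : Set M}, S ⊆ σ '' S' → σ.symm '' S ⊆ S' := by
      rintro S S' hS _ ⟨x, hx, rfl⟩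
      obtain ⟨y, hy, rfl⟩ := hS hx
      simpa using hy
    have hcancel : ∀ S : Set M, σ '' (σ.symm '' S) = S := fun S => by
      rw [Set.image_image]; simp
    obtain ⟨E, hE, hEC, hEs, hi⟩ := h _ (hsub hX) _ (hsub hY) _ (hsub hZ)
      (mk_image_lt _ hXs) (mk_image_lt _ hYs) (mk_image_lt _ hZs)
    refine ⟨σ '' E, ?_, Set.image_mono hEC, mk_image_lt _ hEs, ?_⟩
    · rw [← hcancel Y]; exact Set.image_mono hE
    · have := hind.invariance _ _ _ (mk_image_lt _ hXs) (mk_image_lt _ hZs) hEs σ hi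
      rwa [hcancel, hcancel] at this
  · intro A B C h X hX Y hY Z hZ hXs hYs hZs
    have hXA : #(X ∩ A : Set M) < κbar := mk_lt_of_subset Set.inter_subset_left hXs
    obtain ⟨E, hE, hEC, hEs, hi⟩ := h (X ∩ A) Set.inter_subset_right (Y ∪ X ∩ C)
      (Set.union_subset hY Set.inter_subset_right) Z hZ hXA
      (mk_union_lt h0 hYs (mk_lt_of_subset Set.inter_subset_left hXs)) hZs
    refine ⟨E, Set.subset_union_left.trans hE, hEC, hEs, ?_⟩
    refine hind.mono_left (mk_union_lt h0 hXA hEs) hZs hEs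
      (hind.normality _ _ _ hXA hZs hEs hi) fun x hx => ?_
    rcases hX hx with hA | hC
    · exact .inl ⟨hx, hA⟩
    · exact .inr (hE (.inr ⟨hx, hC⟩))
  · intro A B C D hBC hCD h1 h2
    exact of_finite fun F hF hfin => (iff_fin hfin hBC hCD).2
      ⟨h1.mono hF subset_rfl, h2.mono hF subset_rfl⟩
  · intro A B C D hBC hCD h
    exact of_finite fun F hF hfin => ((iff_fin hfin hBC hCD).1 (h.mono hF subset_rfl)).2
  · intro F hF C
    obtain ⟨C₀, hC₀C, hC₀, hb⟩ := hind.exists_base_of_finite h0 hν hF C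
    refine ⟨C₀, hC₀C, hC₀, ?_⟩
    rw [hind.extInd_iff_of_base h0 (mk_lt_of_finite h0 hF) (hC₀.trans hν) subset_rfl
      fun D hD => hb D (hD.trans hC₀C)]
    rwa [Set.union_eq_left.2 hC₀C]

end IsIndependenceRelation

end ExtInd

open FirstOrder FirstOrder.Language

/-! ### Saturation, homogeneity and automorphisms -/

section ModelTheory

variable {L : FirstOrder.Language.{u, v}} {M : Type w} [L.Structure M] {κbar : Cardinal.{w}}
  {A : Set M}

/-- Saturation, with parameters given by an assignment of variables. -/
theorem isSaturated_iff : IsSaturated L M κbar ↔ ∀ A : Set M, #A < κbar →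
    ∀ Γ : Set (L.Formula (A ⊕ Unit)),
    (∀ Δ ⊆ Γ, Δ.Finite → ∃ x : M, ∀ φ ∈ Δ, φ.Realize (Sum.elim (↑) fun _ => x)) →
    ∃ x : M, ∀ φ ∈ Γ, φ.Realize (Sum.elim (↑) fun _ => x) := by
  have key : ∀ (A : Set M) (φ : L[[A]].Formula Unit) (x : M), φ.Realize (fun _ => x) ↔
      Formula.Realize (L := L) (BoundedFormula.constantsVarsEquiv φ)
        (Sum.elim (↑) fun _ => x) := by
    intro A φ x
    rw [Formula.Realize, Formula.Realize, ← BoundedFormula.realize_constantsVarsEquiv]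
    rfl
  have key' : ∀ (A : Set M) (φ : L.Formula (A ⊕ Unit)) (x : M),
      Formula.Realize (L := L[[A]]) (BoundedFormula.constantsVarsEquiv.symm φ) (fun _ => x) ↔
        φ.Realize (Sum.elim (↑) fun _ => x) := by
    intro A φ x
    rw [key]
    exact iff_of_eq (congrArg (fun ψ : L.Formula (A ⊕ Unit) => ψ.Realize _)
      (Equiv.apply_symm_apply BoundedFormula.constantsVarsEquiv φ))
  constructor
  · intro h A hA Γ hΓ
    obtain ⟨x, hx⟩ := h A hA (BoundedFormula.constantsVarsEquiv.symm '' Γ) fun Δ hΔ hfin => by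
      obtain ⟨Δ', hΔ', hfin', rfl⟩ := Set.exists_subset_image_finite_and.1 ⟨Δ, hΔ, hfin, rfl⟩
      obtain ⟨x, hx⟩ := hΓ Δ' hΔ' hfin'
      refine ⟨x, ?_⟩
      rintro _ ⟨φ, hφ, rfl⟩
      exact (key' A φ x).2 (hx φ hφ)
    exact ⟨x, fun φ hφ => (key' A φ x).1 (hx _ ⟨φ, hφ, rfl⟩)⟩
  · intro h A hA Γ hΓ
    obtain ⟨x, hx⟩ := h A hA (BoundedFormula.constantsVarsEquiv '' Γ) fun Δ hΔ hfin => by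
      obtain ⟨Δ', hΔ', hfin', rfl⟩ := Set.exists_subset_image_finite_and.1 ⟨Δ, hΔ, hfin, rfl⟩
      obtain ⟨x, hx⟩ := hΓ Δ' hΔ' hfin'
      refine ⟨x, ?_⟩
      rintro _ ⟨φ, hφ, rfl⟩
      exact (key A φ x).1 (hx φ hφ)
    exact ⟨x, fun φ hφ => (key A φ x).2 (hx _ ⟨φ, hφ, rfl⟩)⟩

theorem IsSaturated.of_equiv {N : Type w} [L.Structure N] (h : IsSaturated L M κbar)
    (e : M ≃[L] N) : IsSaturated L N κbar := by
  rw [isSaturated_iff] at h ⊢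
  intro A hA Γ hΓ
  have hmem : ∀ a : A, e.symm a ∈ e.symm '' A := fun a => ⟨a, a.2, rfl⟩
  have key : ∀ (φ : L.Formula (A ⊕ Unit)) (x : M),
      Formula.Realize (φ.relabel (Sum.map (fun a : A => (⟨e.symm a, hmem a⟩ : e.symm '' A)) id))
        (Sum.elim (↑) fun _ => x) ↔ φ.Realize (Sum.elim (↑) fun _ => e x) := by
    intro φ x
    rw [Formula.realize_relabel, ← StrongHomClass.realize_formula e]
    refine iff_of_eq (congrArg _ (funext fun i => ?_))
    rcases i with a | _ <;> simp
  obtain ⟨x, hx⟩ := h (e.symm '' A) (Cardinal.mk_image_le.trans_lt hA)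
    ((fun φ => φ.relabel (Sum.map (fun a : A => (⟨e.symm a, hmem a⟩ : e.symm '' A)) id)) '' Γ)
    fun Δ hΔ hfin => by
      obtain ⟨Δ', hΔ', hfin', rfl⟩ := Set.exists_subset_image_finite_and.1 ⟨Δ, hΔ, hfin, rfl⟩
      obtain ⟨x, hx⟩ := hΓ Δ' hΔ' hfin'
      refine ⟨e.symm x, ?_⟩
      rintro _ ⟨φ, hφ, rfl⟩
      exact (key φ _).2 (by simpa using hx φ hφ)
  exact ⟨e x, fun φ hφ => (key φ x).1 (hx _ ⟨φ, hφ, rfl⟩)⟩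

/-- Saturation for a directed family of nonempty sets, not assumed definable: some point satisfies
every formula over `A` that holds throughout a member of the family. -/
theorem IsSaturated.exists_of_directed (h : IsSaturated L M κbar) (hA : #A < κbar)
    {ι : Type*} [Nonempty ι] (X : ι → Set M) (hdir : ∀ i j, ∃ k, X k ⊆ X i ∩ X j)
    (hne : ∀ i, (X i).Nonempty) :
    ∃ b : M, ∀ i, ∀ φ : L.Formula (A ⊕ Unit),
      (∀ x ∈ X i, φ.Realize (Sum.elim (↑) fun _ => x)) →
        φ.Realize (Sum.elim (↑) fun _ => b) := by
  obtain ⟨b, hb⟩ := isSaturated_iff.1 h A hA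
    {φ | ∃ i, ∀ x ∈ X i, φ.Realize (Sum.elim (↑) fun _ => x)} fun Δ hΔ hfin => by
      have : ∃ k, ∀ φ ∈ Δ, ∀ x ∈ X k, φ.Realize (Sum.elim (↑) fun _ => x) := by
        induction Δ, hfin using Set.Finite.induction_on with
        | empty => exact ⟨Classical.arbitrary ι, by simp⟩
        | @insert φ s _ _ ih =>
          obtain ⟨i, hi⟩ := ih fun ψ hψ => hΔ (.inr hψ)
          obtain ⟨j, hj⟩ := hΔ (Set.mem_insert φ s)
          obtain ⟨k, hk⟩ := hdir i j
          refine ⟨k, ?_⟩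
          rintro ψ (rfl | hψ) x hx
          · exact hj x (hk hx).2
          · exact hi ψ hψ x (hk hx).1
      obtain ⟨k, hk⟩ := this
      obtain ⟨x, hx⟩ := hne k
      exact ⟨x, fun φ hφ => hk φ hφ x hx⟩
  exact ⟨b, fun i φ hφ => hb φ ⟨i, hφ⟩⟩

/-- The truth of a formula with parameters in `A` depends on finitely many of them. -/
theorem exists_finite_support {α : Type*} (φ : L.Formula (A ⊕ α)) : ∃ F ⊆ A, F.Finite ∧
    ∀ (v w : A ⊕ α → M), (∀ a : A, (a : M) ∈ F → v (.inl a) = w (.inl a)) →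
      (∀ i, v (.inr i) = w (.inr i)) → (φ.Realize v ↔ φ.Realize w) := by
  classical
  refine ⟨Subtype.val '' (Sum.inl ⁻¹' (φ.freeVarFinset : Set (A ⊕ α)) : Set A), by simp,
    ((φ.freeVarFinset.finite_toSet).preimage Sum.inl_injective.injOn).image _,
    fun v w hv hw => ?_⟩
  rw [Formula.Realize, Formula.Realize, ← BoundedFormula.realize_restrictFreeVar' subset_rfl,
    ← BoundedFormula.realize_restrictFreeVar' (v := w) subset_rfl]
  refine iff_of_eq (congrArg (fun u => BoundedFormula.Realize _ u _) (funext ?_))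
  rintro ⟨a | i, hi⟩
  · exact hv a ⟨a, hi, rfl⟩
  · exact hw i

/-- In a strongly homogeneous structure, two points with the same type over a small set are
conjugate over it. -/
theorem IsStronglyHomogeneous.exists_aut_of_type (hom : IsStronglyHomogeneous L M κbar)
    (h0 : ℵ₀ ≤ κbar) (hA : #A < κbar) {b b' : M}
    (h : ∀ φ : L.Formula (A ⊕ Unit), φ.Realize (Sum.elim (↑) fun _ => b) →
      φ.Realize (Sum.elim (↑) fun _ => b')) :
    ∃ σ : M ≃[L] M, (∀ a ∈ A, σ a = a) ∧ σ b = b' := by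
  classical
  have hiff : ∀ φ : L.Formula (A ⊕ Unit), φ.Realize (Sum.elim (↑) fun _ => b) ↔
      φ.Realize (Sum.elim (↑) fun _ => b') := fun φ =>
    ⟨h φ, fun h' => by_contra fun hn => (h φ.not hn) h'⟩
  have hbA : ∀ a ∈ A, a = b → b' = a := by
    intro a ha hab
    have := h ((Term.var (.inl ⟨a, ha⟩)).equal (Term.var (.inr ()))) (by simp [hab])
    simpa using this.symm
  set f : M → M := fun x => if x = b then b' else x with hf
  have hfA : ∀ a ∈ A, f a = a := fun a ha => by
    by_cases hab : a = b
    · rw [hf]; simp only [hab, if_true]; rw [hbA a ha hab, hab]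
    · simp [hf, hab]
  have hel : IsElementaryOn L f (A ∪ {b}) := by
    intro n φ x hx
    set g : Fin n → A ⊕ Unit := fun i =>
      if h : x i ∈ A then .inl ⟨x i, h⟩ else .inr () with hg
    have h1 : (Sum.elim (↑) fun _ => b) ∘ g = x := funext fun i => by
      by_cases hi : x i ∈ A
      · simp [hg, hi]
      · simp only [hg, Function.comp, hi, dif_neg, not_false_eq_true, Sum.elim_inr]
        exact (((hx i).resolve_left hi : x i = b)).symm
    have h2 : (Sum.elim (↑) fun _ => b') ∘ g = f ∘ x := funext fun i => by
      by_cases hi : x i ∈ A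
      · simp [hg, hi, hfA _ hi]
      · have : x i = b := (hx i).resolve_left hi
        simp only [hg, Function.comp, hi, dif_neg, not_false_eq_true, Sum.elim_inr]
        simp [hf, this]
    have := hiff (φ.relabel g)
    rw [Formula.realize_relabel, Formula.realize_relabel, h1, h2] at this
    exact this.symm
  obtain ⟨σ, hσ⟩ := hom _ (mk_union_lt h0 hA (mk_lt_of_finite h0 (Set.finite_singleton b))) f hel
  exact ⟨σ, fun a ha => (hσ a (.inl ha)).trans (hfA a ha), by simp [hσ b (.inr rfl), hf]⟩

/-- Moving a small set `D` over a small set `A` to one with a property `Q` of finite character, when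
this can be done one point at a time. The proof applies Zorn's lemma to the graphs of restrictions
of automorphisms. -/
theorem IsStronglyHomogeneous.exists_aut_image (hom : IsStronglyHomogeneous L M κbar)
    (h0 : ℵ₀ ≤ κbar) {D : Set M} (hA : #A < κbar) (hD : #D < κbar) (Q : Set M → Prop)
    (hmono : ∀ {X Y : Set M}, X ⊆ Y → Q Y → Q X)
    (hfin : ∀ {X : Set M}, (∀ F ⊆ X, F.Finite → Q F) → Q X) (hempty : Q ∅)
    (step : ∀ σ : M ≃[L] M, (∀ a ∈ A, σ a = a) → ∀ S ⊆ D, ∀ c ∈ D, Q (σ '' S) →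
      ∃ τ : M ≃[L] M, (∀ a ∈ A, τ a = a) ∧ (∀ x ∈ S, τ (σ x) = σ x) ∧
        Q (insert (τ (σ c)) (σ '' S))) :
    ∃ σ : M ≃[L] M, (∀ a ∈ A, σ a = a) ∧ Q (σ '' D) := by
  classical
  set 𝒢 : Set (Set (M × M)) := {g | Q (Prod.snd '' g) ∧ ∃ σ : M ≃[L] M, (∀ a ∈ A, σ a = a) ∧
    ∀ p ∈ g, p.1 ∈ D ∧ p.2 = σ p.1} with h𝒢
  obtain ⟨g, hg⟩ : ∃ g, Maximal (· ∈ 𝒢) g := by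
    refine zorn_subset 𝒢 fun c hc hchain => ?_
    rcases c.eq_empty_or_nonempty with rfl | hne
    · exact ⟨∅, ⟨by simpa using hempty, Language.Equiv.refl L M, by simp, by simp⟩, by simp⟩
    have hdir := hchain.directedOn
    have hsub : ∀ F ⊆ ⋃₀ c, F.Finite → ∃ g ∈ c, F ⊆ g := fun F hF hFfin => by
      obtain ⟨g, hg, hFg⟩ := hdir.exists_mem_subset_of_finite_of_subset_sUnion hne hFfin hF
      exact ⟨g, hg, hFg⟩
    refine ⟨⋃₀ c, ⟨?_, ?_⟩, fun s hs => Set.subset_sUnion_of_mem hs⟩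
    · refine hfin fun F hF hFfin => ?_
      obtain ⟨F', hF', hF'fin, rfl⟩ := Set.exists_subset_image_finite_and.1 ⟨F, hF, hFfin, rfl⟩
      obtain ⟨g, hg, hFg⟩ := hsub F' hF' hF'fin
      exact hmono (Set.image_mono hFg) (hc hg).1
    · -- the union of the graphs is the graph of an elementary map
      set f : M → M := fun x => if h : ∃ y, (x, y) ∈ ⋃₀ c then h.choose else x with hf
      have hfg : ∀ p ∈ ⋃₀ c, p.1 ∈ D ∧ p.2 = f p.1 := by
        rintro p hp
        have hex : ∃ y, (p.1, y) ∈ ⋃₀ c := ⟨p.2, hp⟩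
        have hp' := hex.choose_spec
        obtain ⟨g, hg, hsubg⟩ := hsub {p, (p.1, hex.choose)}
          (by rintro q (rfl | rfl); exacts [hp, hp']) (by simp)
        obtain ⟨-, σ, -, hσ⟩ := hc hg
        have h1 := hσ p (hsubg (.inl rfl))
        have h2 := hσ _ (hsubg (.inr rfl))
        refine ⟨h1.1, ?_⟩
        simp only [hf, hex, dif_pos]
        rw [h1.2]
        exact h2.2.symm
      have hfA : ∀ a ∈ A, f a = a := fun a ha => by
        by_cases hex : ∃ y, (a, y) ∈ ⋃₀ c
        · obtain ⟨y, g, hg, hy⟩ := hex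
          obtain ⟨-, σ, hσA, hσ⟩ := hc hg
          rw [← (hfg (a, y) ⟨g, hg, hy⟩).2, ← hσA a ha]
          exact (hσ _ hy).2
        · simp only [hf, hex, dif_neg, not_false_eq_true]
      have hel : IsElementaryOn L f (A ∪ Prod.fst '' ⋃₀ c) := by
        intro n φ x hx
        obtain ⟨g, hg, hsubg⟩ := hsub ({p | p.2 = f p.1 ∧ p.1 ∈ Set.range x} ∩ ⋃₀ c)
          Set.inter_subset_right <| by
            refine ((Set.finite_range x).image fun y => (y, f y)).subset ?_
            rintro ⟨y, z⟩ ⟨⟨hz, hy⟩, -⟩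
            exact ⟨y, hy, Prod.ext rfl hz.symm⟩
        obtain ⟨-, σ, hσA, hσ⟩ := hc hg
        have : f ∘ x = σ ∘ x := funext fun i => by
          rcases hx i with hi | ⟨p, hp, hpi⟩
          · exact (hfA _ hi).trans (hσA _ hi).symm
          · have h1 := (hfg p hp).2
            have h2 := (hσ p (hsubg ⟨⟨h1, hpi ▸ Set.mem_range_self i⟩, hp⟩)).2
            simp only [Function.comp, ← hpi]
            rw [← h1, h2]
        rw [this]
        exact StrongHomClass.realize_formula σ φ
      obtain ⟨σ, hσ⟩ := hom _ (mk_union_lt h0 hA (mk_lt_of_subset (B := D) (by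
        rintro _ ⟨p, hp, rfl⟩; exact (hfg p hp).1) hD)) f hel
      refine ⟨σ, fun a ha => (hσ a (.inl ha)).trans (hfA a ha), fun p hp => ⟨(hfg p hp).1, ?_⟩⟩
      rw [hσ _ (.inr ⟨p, hp, rfl⟩)]
      exact (hfg p hp).2
  obtain ⟨⟨hQ, σ, hσA, hσ⟩, hmax⟩ := hg
  have himg : ∀ g : Set (M × M), (∀ p ∈ g, p.1 ∈ D ∧ p.2 = σ p.1) →
      Prod.snd '' g = σ '' (Prod.fst '' g) := fun g hg => by
    rw [Set.image_image]; exact Set.image_congr fun p hp => (hg p hp).2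
  have hall : D ⊆ Prod.fst '' g := by
    intro c hcD
    obtain ⟨τ, hτA, hτS, hQτ⟩ := step σ hσA (Prod.fst '' g)
      (by rintro _ ⟨p, hp, rfl⟩; exact (hσ p hp).1) c hcD (himg g hσ ▸ hQ)
    have hmem : insert (c, τ (σ c)) g ∈ 𝒢 := by
      refine ⟨by rwa [Set.image_insert_eq, himg g hσ], τ.comp σ, fun a ha => ?_, ?_⟩
      · simp [hσA a ha, hτA a ha]
      · rintro p (rfl | hp)
        · exact ⟨hcD, by simp⟩
        · refine ⟨(hσ p hp).1, ?_⟩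
          rw [(hσ p hp).2]
          exact (hτS _ ⟨p, hp, rfl⟩).symm
    exact ⟨_, hmax hmem (Set.subset_insert _ _) (Set.mem_insert _ _), rfl⟩
  exact ⟨σ, hσA, hmono (Set.image_mono hall) (himg g hσ ▸ hQ)⟩

end ModelTheory

/-! ### Back-and-forth between lovely pairs -/

section PairLanguage

variable {L : FirstOrder.Language.{u, v}} {M : Type w} [L.Structure M] {P : Set M} {α : Type*}

/-- An `L`-formula, as an `L²`-formula. -/
def liftFormula (φ : L.Formula α) : (pairLanguage L).Formula α :=
  (LHom.sumInl : L →ᴸ L.sum predLanguage).onFormula φ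

theorem realize_liftFormula (φ : L.Formula α) (v : α → M) :
    letI := pairStructure L P
    (liftFormula φ).Realize v ↔ φ.Realize v :=
  let := predStructure P
  LHom.realize_onFormula (LHom.sumInl : L →ᴸ L.sum predLanguage) φ

/-- The `L²`-formula `x ∈ P`. -/
def memFormula (L : FirstOrder.Language.{u, v}) (i : α) : (pairLanguage L).Formula α :=
  Relations.formula (L := pairLanguage L) (n := 1) (Sum.inr PredRel.mem) fun _ => Term.var i

theorem realize_memFormula (i : α) (v : α → M) :
    letI := pairStructure L P
    (memFormula L i).Realize v ↔ v i ∈ P :=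
  let := pairStructure L P
  Formula.realize_rel

/-- Automorphisms of the pair are the automorphisms of `M` that preserve `P`. -/
theorem exists_reduct_aut (σ : letI := pairStructure L P; M ≃[pairLanguage L] M) :
    ∃ ρ : M ≃[L] M, (∀ x, ρ x = σ x) ∧ ρ '' P = P := by
  let := pairStructure L P
  have hP : ∀ x, σ x ∈ P ↔ x ∈ P := fun x =>
    StrongHomClass.map_rel σ (Sum.inr PredRel.mem : (pairLanguage L).Relations 1) ![x]
  refine ⟨⟨σ.toEquiv, fun f x => σ.map_fun (Sum.inl f) x, fun R x => σ.map_rel (Sum.inl R) x⟩,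
    fun x => rfl, ?_⟩
  ext y
  constructor
  · rintro ⟨x, hx, rfl⟩
    exact (hP x).2 hx
  · intro hy
    obtain ⟨x, rfl⟩ := σ.toEquiv.surjective y
    exact ⟨x, (hP x).1 hy, rfl⟩

/-- The language `L²` has no terms beyond those of `L`. -/
theorem realize_term_aut (σ : M ≃[L] M) (t : (pairLanguage L).Term α) (v : α → M) :
    letI := pairStructure L P
    t.realize (σ ∘ v) = σ (t.realize v) := by
  let := pairStructure L P
  induction t with
  | var i => rfl
  | @func n f ts ih =>
    rcases f with f | f
    · have h : (fun i => (ts i).realize (σ ∘ v)) = σ ∘ fun i => (ts i).realize v := funext ih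
      simp only [Term.realize, h]
      exact (σ.map_fun f _).symm
    · exact f.elim

end PairLanguage

section LovelyPairs

variable {L : FirstOrder.Language.{u, v}} {M : Type w} [L.Structure M]
  {I : Set M → Set M → Set M → Prop} {ν κ κbar : Cardinal.{w}} {P A B C D E : Set M}

theorem image_comp_aut (τ σ : M ≃[L] M) (S : Set M) : τ.comp σ '' S = τ '' (σ '' S) :=
  (Set.image_image τ σ S).symm

theorem symm_image_image (σ : M ≃[L] M) (S : Set M) : σ.symm '' (σ '' S) = S := by
  simp [Set.image_image]

theorem symm_comp_comp {β : Type*} (σ : M ≃[L] M) (u : β → M) : σ.symm ∘ σ ∘ u = u :=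
  funext fun i => σ.symm_apply_apply (u i)

theorem comp_eq_comp_of_eqOn {β : Type*} {f g : M → M} (hfg : ∀ x ∈ E, f x = g x) {u : β → M}
    (hu : ∀ i, u i ∈ E) : f ∘ u = g ∘ u :=
  funext fun i => hfg _ (hu i)

variable (L) in
/-- Loveliness of the pair `⟨M, P⟩`, where `M` is itself strongly homogeneous, in terms of
automorphisms of `M`: types over `A` are orbits under the automorphisms that fix `A` pointwise. -/
structure LovelyUnderAut (I : Set M → Set M → Set M → Prop) (ν κ : Cardinal.{w}) (P : Set M) :
    Prop where
  global : GlobalIndependence L I ν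
  infinite : ℵ₀ ≤ ν
  lt : ν < κ
  density : ∀ A : Set M, #A < κ → ∀ b : M, I {b} (P ∩ A) A →
    ∃ σ : M ≃[L] M, (∀ a ∈ A, σ a = a) ∧ σ b ∈ P
  extension : ∀ A : Set M, #A < κ → ∀ b : M,
    ∃ σ : M ≃[L] M, (∀ a ∈ A, σ a = a) ∧ I {σ b} A P

/-- A partial isomorphism of pairs between subsets that are independent from `P` over their
intersection with `P`. Since only a set `Q` of elements of `P ∩ E`, with image in `P`, is mentioned,
it is not required that the remaining points of `E` and of `σ '' E` correspond with respect to `P`;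
this follows, by `LovelyUnderAut.mem_iff_of_pairIso`. -/
def PairIso (I : Set M → Set M → Set M → Prop) (P E : Set M) (σ : M ≃[L] M) : Prop :=
  ∃ Q ⊆ E, Q ⊆ P ∧ σ '' Q ⊆ P ∧ I E Q P ∧ I (σ '' E) (σ '' Q) P

namespace PairIso

variable {σ τ : M ≃[L] M}

theorem symm (h : PairIso I P E σ) : PairIso I P (σ '' E) σ.symm := by
  obtain ⟨Q, hQE, hQP, hσQ, h1, h2⟩ := h
  refine ⟨σ '' Q, Set.image_mono hQE, hσQ, ?_, h2, ?_⟩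
  · rwa [symm_image_image]
  · rwa [symm_image_image, symm_image_image]

theorem congr (h : PairIso I P E σ) (hτ : ∀ x ∈ E, τ x = σ x) : PairIso I P E τ := by
  obtain ⟨Q, hQE, hQP, hσQ, h1, h2⟩ := h
  refine ⟨Q, hQE, hQP, ?_⟩
  rw [Set.image_congr hτ, Set.image_congr fun x hx => hτ x (hQE hx)]
  exact ⟨hσQ, h1, h2⟩

theorem union (hI : GlobalIndependence L I ν) (h : PairIso I P E σ) (hD : D ⊆ P)
    (hσD : σ '' D ⊆ P) : PairIso I P (E ∪ D) σ := by
  have key : ∀ {E Q D : Set M}, D ⊆ P → I E Q P → I (E ∪ D) (Q ∪ D) P := fun {E Q D} hD h =>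
    hI.mono_left (Set.union_subset_union_right _ Set.subset_union_right)
      (hI.union_left (hI.base_up Set.subset_union_left
        (Set.union_subset Set.subset_union_right (hD.trans Set.subset_union_left)) h))
  obtain ⟨Q, hQE, hQP, hσQ, h1, h2⟩ := h
  refine ⟨Q ∪ D, Set.union_subset_union_left D hQE, Set.union_subset hQP hD, ?_, key hD h1, ?_⟩
  · rw [Set.image_union]
    exact Set.union_subset hσQ hσD
  · rw [Set.image_union, Set.image_union]
    exact key hσD h2

theorem insert (hI : GlobalIndependence L I ν) (h : PairIso I P E σ) {c : M} (hc : I {c} E P)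
    (hσc : I {σ c} (σ '' E) P) : PairIso I P (insert c E) σ := by
  have key : ∀ {E Q : Set M} {c : M}, Q ⊆ E → I E Q P → I {c} E P → I (Insert.insert c E) Q P :=
    fun {E Q c} hQ h hc => hI.union_of (B := {c}) h (by rwa [Set.union_eq_right.2 hQ])
  obtain ⟨Q, hQE, hQP, hσQ, h1, h2⟩ := h
  refine ⟨Q, hQE.trans (Set.subset_insert _ _), hQP, hσQ, key hQE h1 hc, ?_⟩
  rw [Set.image_insert_eq]
  exact key (Set.image_mono hQE) h2 hσc

/-- A small subset of the domain of a partial isomorphism of pairs is contained in the domain of a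
small one. -/
theorem exists_small (hI : GlobalIndependence L I ν) (h0 : ℵ₀ < κ) (hν : ν < κ)
    (h : PairIso I P E σ) {F : Set M} (hF : F ⊆ E) (hFκ : #F < κ) :
    ∃ E₀, F ⊆ E₀ ∧ #E₀ < κ ∧ PairIso I P E₀ σ := by
  obtain ⟨Q, hQE, hQP, hσQ, h1, h2⟩ := h
  obtain ⟨D, hDQ, hDκ, hi⟩ := hI.exists_base h0 hν hFκ Q
  refine ⟨F ∪ D, Set.subset_union_left, mk_union_lt h0.le hFκ hDκ, D, Set.subset_union_right,
    hDQ.trans hQP, (Set.image_mono hDQ).trans hσQ, ?_, ?_⟩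
  · exact hI.union_left (hI.base_down hDQ hi (hI.mono_left hF h1))
  · rw [Set.image_union]
    exact hI.union_left (hI.base_down (Set.image_mono hDQ) (hI.invariance σ hi)
      (hI.mono_left (Set.image_mono hF) h2))

end PairIso

namespace LovelyUnderAut

variable (h : LovelyUnderAut L I ν κ P)
include h

theorem aleph0_lt : ℵ₀ < κ := h.infinite.trans_lt h.lt

/-- The closure of `P` is `P`. -/
theorem mem_of_self {c : M} (hc : I {c} P {c}) : c ∈ P := by
  obtain ⟨C₀, hC₀P, hC₀, hi⟩ := h.global.local_base (Set.finite_singleton c) P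
  by_contra hcP
  have h1 := h.global.union_right (h.global.base_down hC₀P hi hc)
  have h2 : P ∩ ({c} ∪ C₀) = C₀ := by
    ext x
    constructor
    · rintro ⟨hx, rfl | hx'⟩
      · exact absurd hx hcP
      · exact hx'
    · exact fun hx => ⟨hC₀P hx, .inr hx⟩
  obtain ⟨σ, hσ, hσP⟩ := h.density ({c} ∪ C₀)
    (mk_union_lt h.aleph0_lt.le (mk_lt_of_finite h.aleph0_lt.le (Set.finite_singleton c))
      (hC₀.trans h.lt)) c (by rwa [h2])
  exact hcP (hσ c (.inl rfl) ▸ hσP)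

/-- The density property for sets instead of points. -/
theorem density_set (hom : IsStronglyHomogeneous L M κbar) (hκ : κ ≤ κbar) (hA : #A < κ)
    (hD : #D < κ) (hi : I D (P ∩ A) A) :
    ∃ σ : M ≃[L] M, (∀ a ∈ A, σ a = a) ∧ σ '' D ⊆ P := by
  refine hom.exists_aut_image (h.aleph0_lt.le.trans hκ) (hA.trans_le hκ) (hD.trans_le hκ)
    (fun X => X ⊆ P) (fun hXY hY => hXY.trans hY)
    (fun hX x hx => hX {x} (by simpa using hx) (Set.finite_singleton x) rfl)
    (Set.empty_subset P) fun σ hσ S hSD c hc hS => ?_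
  have hs : #(A ∪ σ '' S : Set M) < κ :=
    mk_union_lt h.aleph0_lt.le hA (mk_image_lt _ (mk_lt_of_subset hSD hD))
  have hcS : ({c} ∪ S) ⊆ D := Set.union_subset (by simpa using hc) hSD
  have h1 : I {c} ((P ∩ A) ∪ S) A := by
    have := h.global.symm (h.global.mono_left hcS hi)
    refine h.global.symm (h.global.mono_right Set.subset_union_left
      (h.global.base_up (B := {c} ∪ S) Set.subset_union_left ?_ this))
    exact Set.union_subset Set.subset_union_right
      (Set.subset_union_right.trans Set.subset_union_left)
  have h2 := h.global.union_right h1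
  have h3 := h.global.invariance σ h2
  have hA' : σ '' A = A := image_eq_self_of_fix hσ
  have hPA : σ '' (P ∩ A) = P ∩ A := image_eq_self_of_fix fun a ha => hσ a ha.2
  rw [Set.image_union, Set.image_union σ, hA', hPA, Set.image_singleton] at h3
  have h4 : I {σ c} (P ∩ (A ∪ σ '' S)) (A ∪ σ '' S) := by
    refine h.global.mono_right ?_ (h.global.base_mono ?_ ?_ h3)
    · exact Set.union_subset_union_right _ (Set.image_mono Set.subset_union_right)
    · rintro x (hx | hx)
      · exact ⟨hx.1, .inl hx.2⟩
      · exact ⟨hS hx, .inr hx⟩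
    · rintro x ⟨-, hx | hx⟩
      · exact .inl hx
      · exact .inr (Set.image_mono Set.subset_union_right hx)
  obtain ⟨τ, hτ, hτP⟩ := h.density _ hs _ h4
  exact ⟨τ, fun a ha => hτ a (.inl ha), fun x hx => hτ _ (.inr ⟨x, hx, rfl⟩),
    Set.insert_subset hτP hS⟩

variable {σ : M ≃[L] M}

theorem mem_of_pairIso (hσ : PairIso I P E σ) {e : M} (he : e ∈ E) (heP : e ∈ P) : σ e ∈ P := by
  obtain ⟨Q, -, -, hσQ, h1, -⟩ := hσ
  have h2 := h.global.invariance σ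
    (h.global.mono (A' := {e}) (B' := {e}) (by simpa using he) (by simpa using heP) h1)
  rw [Set.image_singleton] at h2
  -- `σ e` lies in the closure of `σ '' Q`, hence in that of `P`
  exact h.mem_of_self (h.global.mono_right Set.subset_union_left
    (h.global.base_mono hσQ Set.subset_union_right (h.global.of_self h2 ({σ e} ∪ P))))

theorem mem_iff_of_pairIso (hσ : PairIso I P E σ) {e : M} (he : e ∈ E) : σ e ∈ P ↔ e ∈ P :=
  ⟨fun h' => by simpa using h.mem_of_pairIso hσ.symm ⟨e, he, rfl⟩ h', h.mem_of_pairIso hσ he⟩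

/-- The forth step of the back-and-forth argument. A base of `c` in `P` is added first, by density;
then `c` is independent from `P` over the new domain and the extension property applies. -/
theorem exists_pairIso_extension (hom : IsStronglyHomogeneous L M κbar) (hκ : κ ≤ κbar)
    (hE : #E < κ) (hσ : PairIso I P E σ) (c : M) :
    ∃ (E' : Set M) (τ : M ≃[L] M), E ⊆ E' ∧ c ∈ E' ∧ #E' < κ ∧ (∀ x ∈ E, τ x = σ x) ∧
      PairIso I P E' τ := by
  have h0 := h.aleph0_lt.le
  obtain ⟨G, hG, hGν, hc⟩ := h.global.local_base (Set.finite_singleton c) (E ∪ P)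
  set D := G ∩ P with hD
  have hDκ : #D < κ := mk_lt_of_subset Set.inter_subset_left (hGν.trans h.lt)
  have hDP : D ⊆ P := Set.inter_subset_right
  have hcD : I {c} (E ∪ D) P := by
    refine h.global.mono_right Set.subset_union_right (h.global.base_mono ?_ ?_ hc)
    · intro x hx
      exact (hG hx).imp id fun hP => ⟨hx, hP⟩
    · exact Set.union_subset_union_right _ hDP
  obtain ⟨τ, hτ, hτD⟩ : ∃ τ : M ≃[L] M, (∀ a ∈ σ '' E, τ a = a) ∧ τ '' (σ '' D) ⊆ P := by
    obtain ⟨Q, hQE, hQP, hσQ, h1, h2⟩ := hσ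
    refine h.density_set hom hκ (mk_image_lt _ hE) (mk_image_lt _ hDκ) ?_
    have h3 := h.global.invariance σ (h.global.symm (h.global.mono_right hDP h1))
    refine h.global.base_up ?_ (fun x hx => .inl hx.2) h3
    exact fun x hx => ⟨hσQ hx, Set.image_mono hQE hx⟩
  have hτσ : ∀ x ∈ E, τ.comp σ x = σ x := fun x hx => hτ _ ⟨x, hx, rfl⟩
  have hσ₁ : PairIso I P (E ∪ D) (τ.comp σ) :=
    (hσ.congr hτσ).union h.global hDP (by rwa [image_comp_aut])
  have hED : #(E ∪ D : Set M) < κ := mk_union_lt h0 hE hDκ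
  obtain ⟨ρ, hρ, hρc⟩ := h.extension _ (mk_image_lt (τ.comp σ) hED) (τ.comp σ c)
  have hρσ : ∀ x ∈ E ∪ D, ρ.comp (τ.comp σ) x = τ.comp σ x := fun x hx => hρ _ ⟨x, hx, rfl⟩
  refine ⟨insert c (E ∪ D), ρ.comp (τ.comp σ), Set.subset_union_left.trans (Set.subset_insert _ _),
    Set.mem_insert _ _, ?_, fun x hx => (hρσ x (.inl hx)).trans (hτσ x hx), ?_⟩
  · exact mk_union_lt h0 (A := {c}) (mk_lt_of_finite h0 (Set.finite_singleton c)) hED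
  · refine (hσ₁.congr hρσ).insert h.global hcD ?_
    rwa [Set.image_congr hρσ]

/-- Back-and-forth: partial isomorphisms of pairs preserve all `L²`-formulas. -/
theorem realize_of_pairIso (hom : IsStronglyHomogeneous L M κbar) (hκ : κ ≤ κbar) {α : Type*}
    {n : ℕ} (φ : (pairLanguage L).BoundedFormula α n) :
    letI := pairStructure L P
    ∀ {E : Set M} {σ : M ≃[L] M}, #E < κ → PairIso I P E σ → ∀ (v : α → M) (xs : Fin n → M),
      (∀ i, v i ∈ E) → (∀ i, xs i ∈ E) → (φ.Realize (σ ∘ v) (σ ∘ xs) ↔ φ.Realize v xs) := by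
  let := pairStructure L P
  have hterm : ∀ {n : ℕ} (σ : M ≃[L] M) (t : (pairLanguage L).Term (α ⊕ Fin n)) (v : α → M)
      (xs : Fin n → M), t.realize (Sum.elim (σ ∘ v) (σ ∘ xs)) = σ (t.realize (Sum.elim v xs)) :=
    fun σ t v xs => by rw [← Sum.comp_elim]; exact realize_term_aut σ t _
  induction φ with
  | falsum => intros; rfl
  | equal t₁ t₂ =>
    intro E σ _ _ v xs _ _
    simp only [BoundedFormula.Realize, hterm, EmbeddingLike.apply_eq_iff_eq]
  | rel R ts =>
    intro E σ hE hσ v xs hv hxs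
    simp only [BoundedFormula.Realize, hterm]
    rcases R with R | R
    · exact σ.map_rel R _
    · cases R
      -- the value of the term need not be in `E`, but it can be added to it
      obtain ⟨E', τ, hEE', hc, -, hτ, hτiso⟩ := h.exists_pairIso_extension hom hκ hE hσ
        ((ts 0).realize (Sum.elim v xs))
      have h1 : τ ((ts 0).realize (Sum.elim v xs)) = σ ((ts 0).realize (Sum.elim v xs)) := by
        rw [← hterm, ← hterm, comp_eq_comp_of_eqOn hτ hv, comp_eq_comp_of_eqOn hτ hxs]
      have h2 := h.mem_iff_of_pairIso hτiso hc
      rw [h1] at h2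
      exact h2
  | imp φ ψ ih₁ ih₂ =>
    intro E σ hE hσ v xs hv hxs
    simp only [BoundedFormula.realize_imp, ih₁ hE hσ v xs hv hxs, ih₂ hE hσ v xs hv hxs]
  | all φ ih =>
    have key : ∀ {E : Set M} {σ : M ≃[L] M}, #E < κ → PairIso I P E σ → ∀ (v : α → M)
        (xs : Fin _ → M), (∀ i, v i ∈ E) → (∀ i, xs i ∈ E) →
        φ.all.Realize (σ ∘ v) (σ ∘ xs) → φ.all.Realize v xs := by
      intro E σ hE hσ v xs hv hxs hall c
      obtain ⟨E', τ, hEE', hc, hE', hτ, hτiso⟩ := h.exists_pairIso_extension hom hκ hE hσ c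
      refine (ih hE' hτiso v (Fin.snoc xs c) (fun i => hEE' (hv i)) fun i => ?_).1 ?_
      · refine Fin.lastCases ?_ (fun j => ?_) i
        · simpa using hc
        · simpa using hEE' (hxs j)
      · rw [Fin.comp_snoc, comp_eq_comp_of_eqOn hτ hv, comp_eq_comp_of_eqOn hτ hxs]
        exact hall (τ c)
    intro E σ hE hσ v xs hv hxs
    refine ⟨key hE hσ v xs hv hxs, fun hall => ?_⟩
    refine key (mk_image_lt σ hE) hσ.symm (σ ∘ v) (σ ∘ xs) (fun i => ⟨_, hv i, rfl⟩)
      (fun i => ⟨_, hxs i, rfl⟩) ?_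
    rw [symm_comp_comp, symm_comp_comp]
    exact hall

theorem isElementaryOn_of_pairIso (hom : IsStronglyHomogeneous L M κbar) (hκ : κ ≤ κbar)
    (hσ : PairIso I P E σ) :
    letI := pairStructure L P
    IsElementaryOn (pairLanguage L) σ E := by
  intro n φ x hx
  obtain ⟨E₀, hE₀, hE₀κ, hiso⟩ := hσ.exists_small h.global h.aleph0_lt h.lt
    (F := Set.range x) (by rintro _ ⟨i, rfl⟩; exact hx i)
    (mk_lt_of_finite h.aleph0_lt.le (Set.finite_range x))
  have := h.realize_of_pairIso hom hκ φ hE₀κ hiso x default (fun i => hE₀ ⟨i, rfl⟩) fun i => i.elim0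
  rw [Subsingleton.elim (σ ∘ default) default] at this
  exact this

end LovelyUnderAut

end LovelyPairs

/-! ### The extension property over small sets -/

section SmallExtension

variable {L : FirstOrder.Language.{u, v}} {M : Type w} [L.Structure M]
  {I : Set M → Set M → Set M → Prop} {ν κ κbar : Cardinal.{w}} {P A B C D E Q : Set M}

namespace LovelyUnderAut

variable (h : LovelyUnderAut L I ν κ P)
include h

/-- The extension property over a small set `A` of any size, when `A` is independent from `P` over a
subset of `P`. The automorphisms that move `b` to a point independent from `P` over `A₁`, where `A₁`
runs through the subsets of `A` with fewer than `κ` elements that contain a fixed base of `b` in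
`A`, give by saturation of `⟨M, P⟩` a single point `b'`. By back-and-forth, if `A₁` is independent
from `P` over a subset of `P ∩ A₁`, then `b'` has the `L²`-type of these points over `A₁`, and is
therefore independent from `P` over `A₁`. -/
theorem extension_of_free (hom : IsStronglyHomogeneous L M κbar) (hκ : κ ≤ κbar)
    {T₂ : (pairLanguage L).Theory}
    (hP : letI := pairStructure L P; IsMonsterModel M T₂ κbar)
    (hA : #A < κbar) (hQA : Q ⊆ A) (hQP : Q ⊆ P) (hQ : I A Q P) (b : M) :
    ∃ σ : M ≃[L] M, (∀ a ∈ A, σ a = a) ∧ I {σ b} A P := by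
  let := pairStructure L P
  have h0 := h.aleph0_lt.le
  have hI := h.global
  obtain ⟨A₀, hA₀A, hA₀ν, hb₀⟩ := hI.local_base (Set.finite_singleton b) A
  have hA₀ := hA₀ν.trans h.lt
  let ι := {A₁ : Set M // A₀ ⊆ A₁ ∧ A₁ ⊆ A ∧ #A₁ < κ}
  let X : ι → Set M := fun i =>
    {x | ∃ σ : M ≃[L] M, (∀ a ∈ i.1, σ a = a) ∧ σ b = x ∧ I {x} i.1 P}
  have : Nonempty ι := ⟨⟨A₀, subset_rfl, hA₀A, hA₀⟩⟩
  have hanti : ∀ i j : ι, i.1 ⊆ j.1 → X j ⊆ X i := by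
    rintro i j hij x ⟨σ, hσ, rfl, hx⟩
    refine ⟨σ, fun a ha => hσ a (hij ha), rfl, hI.base_down hij ?_ hx⟩
    have h1 := hI.invariance σ (hI.mono_right j.2.2.1 (hI.base_mono i.2.1 i.2.2.1 hb₀))
    rwa [Set.image_singleton, image_eq_self_of_fix hσ,
      image_eq_self_of_fix fun a ha => hσ a (hij ha)] at h1
  obtain ⟨b', hb'⟩ := hP.saturated.exists_of_directed hA X
    (fun i j => ⟨⟨i.1 ∪ j.1, i.2.1.trans Set.subset_union_left, Set.union_subset i.2.2.1 j.2.2.1,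
      mk_union_lt h0 i.2.2.2 j.2.2.2⟩, Set.subset_inter (hanti _ _ Set.subset_union_left)
        (hanti _ _ Set.subset_union_right)⟩)
    (fun i => by
      obtain ⟨σ, hσ, hi⟩ := h.extension i.1 i.2.2.2 b
      exact ⟨σ b, σ, hσ, rfl, hi⟩)
  obtain ⟨σ, hσ, hσb⟩ := hom.exists_aut_of_type (h0.trans hκ) hA (b := b) (b' := b') fun φ hφ => by
    obtain ⟨F, hFA, hFfin, hF⟩ := exists_finite_support φ
    let i : ι := ⟨A₀ ∪ F, Set.subset_union_left, Set.union_subset hA₀A hFA,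
      mk_union_lt h0 hA₀ (mk_lt_of_finite h0 hFfin)⟩
    refine (realize_liftFormula φ _).1 (hb' i (liftFormula φ) ?_)
    rintro x ⟨σ, hσ, rfl, -⟩
    refine (realize_liftFormula φ _).2 ?_
    rw [← StrongHomClass.realize_formula σ] at hφ
    exact (hF (σ ∘ Sum.elim (↑) fun _ => b) (Sum.elim (↑) fun _ => σ b)
      (fun a ha => hσ a (.inr ha)) fun _ => rfl).1 hφ
  refine ⟨σ, hσ, ?_⟩
  rw [hσb]
  have hbA : I {b'} A₀ A := by
    have := hI.invariance σ hb₀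
    rwa [Set.image_singleton, hσb, image_eq_self_of_fix hσ,
      image_eq_self_of_fix fun a ha => hσ a (hA₀A ha)] at this
  suffices hAP : I {b'} A₀ (A ∪ P) from
    hI.mono_right Set.subset_union_right (hI.base_mono hA₀A Set.subset_union_left hAP)
  refine hI.of_finite_right fun F hF hFfin => ?_
  -- a subset `A₁` of `A`, with fewer than `κ` elements, that contains `A₀` and `F ∩ A` and is
  -- independent from `P` over a subset of `P`
  have hA₀F : #(A₀ ∪ F ∩ A : Set M) < κ :=
    mk_union_lt h0 hA₀ (mk_lt_of_finite h0 (hFfin.subset Set.inter_subset_left))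
  have hA₀FA : A₀ ∪ F ∩ A ⊆ A := Set.union_subset hA₀A Set.inter_subset_right
  obtain ⟨D, hDQ, hDκ, hD⟩ := hI.exists_base h.aleph0_lt h.lt hA₀F Q
  set A₁ := A₀ ∪ F ∩ A ∪ D with hA₁
  have hA₁κ : #A₁ < κ := mk_union_lt h0 hA₀F hDκ
  have hA₁A : A₁ ⊆ A := Set.union_subset hA₀FA (hDQ.trans hQA)
  have hA₁P : I A₁ D P := hI.union_left (hI.base_down hDQ hD (hI.mono_left hA₀FA hQ))
  have hA₀A₁ : A₀ ⊆ A₁ := Set.subset_union_left.trans Set.subset_union_left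
  let i : ι := ⟨A₁, hA₀A₁, hA₁A, hA₁κ⟩
  obtain ⟨σ₁, hσ₁, hi₁⟩ := h.extension A₁ hA₁κ b
  have htype : ∀ φ : (pairLanguage L).Formula (A₁ ⊕ Unit),
      φ.Realize (Sum.elim (↑) fun _ => σ₁ b) → φ.Realize (Sum.elim (↑) fun _ => b') := by
    intro φ hφ
    have h1 := hb' i (φ.relabel (Sum.map (Set.inclusion hA₁A) id)) ?_
    · rw [Formula.realize_relabel] at h1
      convert h1 using 1
      exact funext fun j => by rcases j with _ | _ <;> rfl
    rintro _ ⟨σ₂, hσ₂, rfl, hi₂⟩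
    have hfix : ∀ a ∈ A₁, σ₂.comp σ₁.symm a = a := fun a ha => by
      rw [Language.Equiv.comp_apply]
      conv_lhs => rw [← hσ₁ a ha, σ₁.symm_apply_apply]
      exact hσ₂ a ha
    have hiso : PairIso I P A₁ (σ₂.comp σ₁.symm) := by
      refine ⟨D, Set.subset_union_right, hDQ.trans hQP, ?_, hA₁P, ?_⟩
      · rw [image_eq_self_of_fix fun a ha => hfix a (.inr ha)]
        exact hDQ.trans hQP
      · rwa [image_eq_self_of_fix hfix, image_eq_self_of_fix fun a ha => hfix a (.inr ha)]
    have hiso' := hiso.insert hI hi₁ (by simpa [image_eq_self_of_fix hfix] using hi₂)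
    have h2 := h.realize_of_pairIso hom hκ φ (E := insert (σ₁ b) A₁)
      (mk_union_lt h0 (A := {σ₁ b}) (mk_lt_of_finite h0 (Set.finite_singleton _)) hA₁κ) hiso'
      (Sum.elim (↑) fun _ => σ₁ b) default (by rintro (a | _) <;> simp) fun j => j.elim0
    rw [Subsingleton.elim (σ₂.comp σ₁.symm ∘ default) default] at h2
    rw [Formula.realize_relabel]
    refine (iff_of_eq (congrArg φ.Realize (funext fun j => ?_))).2 (h2.2 hφ)
    rcases j with a | _
    · exact (hfix a a.2).symm
    · simp
  obtain ⟨ρ, hρ, hρb⟩ := hP.homogeneous.exists_aut_of_type (h0.trans hκ) (hA₁κ.trans_le hκ) htype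
  obtain ⟨ρ', hρρ', hρP⟩ := exists_reduct_aut ρ
  have hbA₁ : I {b'} A₁ P := by
    have h1 := hI.invariance ρ' hi₁
    rwa [Set.image_singleton, hρρ', hρb, hρP,
      image_eq_self_of_fix fun a ha => (hρρ' a).trans (hρ a ha)] at h1
  refine hI.mono_right ?_ (hI.trans hA₀A₁ Set.subset_union_right (hI.mono_right hA₁A hbA)
    (hI.union_right hbA₁))
  intro x hx
  rcases hF hx with hxA | hxP
  · exact .inr (.inl (.inr ⟨hx, hxA⟩))
  · exact .inl hxP

/-- The extension property over a small set of any size. -/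
theorem extension_of_small (hom : IsStronglyHomogeneous L M κbar) (hκ : κ ≤ κbar)
    {T₂ : (pairLanguage L).Theory}
    (hP : letI := pairStructure L P; IsMonsterModel M T₂ κbar)
    (hext : ∀ A C B : Set M, #A < κbar → #C < κbar → #B < κbar →
      ∃ σ : M ≃[L] M, (∀ c ∈ C, σ c = c) ∧ I (σ '' A) C B)
    (hA : #A < κbar) (b : M) :
    ∃ σ : M ≃[L] M, (∀ a ∈ A, σ a = a) ∧ I {σ b} A P := by
  have h0 := h.aleph0_lt.trans_le hκ
  have hI := h.global
  obtain ⟨Q, hQP, hQ, hi⟩ := hI.exists_base h0 (h.lt.trans_le hκ) hA P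
  have hAQ := mk_union_lt h0.le hA hQ
  -- `b` is first made independent from `Q` over `A`
  obtain ⟨τ, hτ, hτb⟩ := hext {b} A (A ∪ Q) (mk_lt_of_finite h0.le (Set.finite_singleton b)) hA hAQ
  obtain ⟨σ, hσ, hσb⟩ := h.extension_of_free hom hκ hP hAQ Set.subset_union_right hQP
    (hI.union_left hi) (τ b)
  refine ⟨σ.comp τ, fun a ha => ?_, ?_⟩
  · simp [hτ a ha, hσ a (.inl ha)]
  · have h1 := hI.invariance σ hτb
    rw [Set.image_singleton, Set.image_singleton, image_eq_self_of_fix hσ,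
      image_eq_self_of_fix fun a ha => hσ a (.inl ha)] at h1
    exact hI.base_down Set.subset_union_left h1 hσb

/-- The extension property for small sets instead of points. -/
theorem extension_set (hom : IsStronglyHomogeneous L M κbar) (hκ : κ ≤ κbar)
    {T₂ : (pairLanguage L).Theory}
    (hP : letI := pairStructure L P; IsMonsterModel M T₂ κbar)
    (hext : ∀ A C B : Set M, #A < κbar → #C < κbar → #B < κbar →
      ∃ σ : M ≃[L] M, (∀ c ∈ C, σ c = c) ∧ I (σ '' A) C B)
    (hA : #A < κbar) (hD : #D < κbar) :
    ∃ σ : M ≃[L] M, (∀ a ∈ A, σ a = a) ∧ I (σ '' D) A P := by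
  have h0 := h.aleph0_lt.le.trans hκ
  have hI := h.global
  refine hom.exists_aut_image h0 hA hD (fun X => I X A P) (fun hXY => hI.mono_left hXY)
    hI.of_finite (hI.mono_left (Set.empty_subset A) (hI.symm (hI.self P A)))
    fun σ hσ S hSD c _ hS => ?_
  obtain ⟨τ, hτ, hτc⟩ := h.extension_of_small hom hκ hP hext
    (mk_union_lt h0 hA (mk_image_lt σ (mk_lt_of_subset hSD hD))) (σ c)
  exact ⟨τ, fun a ha => hτ a (.inl ha), fun x hx => hτ _ (.inr ⟨x, hx, rfl⟩),
    hI.union_of (B := {τ (σ c)}) hS hτc⟩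

/-- Extension for independence over `P`, with respect to `L²`-types. A base `Q` of `A ∪ C` in `P` is
fixed while `A` is made independent from `B` and then from `P`. -/
theorem exists_pair_extension (hom : IsStronglyHomogeneous L M κbar) (hκ : κ ≤ κbar)
    {T₂ : (pairLanguage L).Theory}
    (hP : letI := pairStructure L P; IsMonsterModel M T₂ κbar)
    (hext : ∀ A C B : Set M, #A < κbar → #C < κbar → #B < κbar →
      ∃ σ : M ≃[L] M, (∀ c ∈ C, σ c = c) ∧ I (σ '' A) C B)
    (hA : #A < κbar) (hB : #B < κbar) (hC : #C < κbar) :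
    ∃ A' : Set M, (letI := pairStructure L P; SameType (pairLanguage L) C A' A) ∧
      I A' (C ∪ P) B := by
  have h0 := h.aleph0_lt.trans_le hκ
  have hI := h.global
  obtain ⟨Q, hQP, hQ, hi⟩ := hI.exists_base h0 (h.lt.trans_le hκ) (mk_union_lt h0.le hA hC) P
  have hCQ := mk_union_lt h0.le hC hQ
  obtain ⟨τ, hτ, hτA⟩ := hext A (C ∪ Q) B hA hCQ hB
  obtain ⟨ρ, hρ, hρA⟩ := h.extension_set hom hκ hP hext (mk_union_lt h0.le hB hCQ)
    (mk_image_lt τ hA)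
  set σ := ρ.comp τ with hσdef
  have hσ : ∀ x ∈ C ∪ Q, σ x = x := fun x hx => by simp [hσdef, hτ x hx, hρ x (.inr hx)]
  -- the image of `A` is independent from `B` and `P` together over `C ∪ Q`
  have h1 : I (σ '' A) (C ∪ Q) (P ∪ (B ∪ (C ∪ Q))) := by
    rw [hσdef, image_comp_aut]
    refine hI.trans Set.subset_union_right Set.subset_union_right ?_ (hI.union_right hρA)
    have h2 := hI.invariance ρ (hI.union_right hτA)
    rwa [image_eq_self_of_fix hρ, image_eq_self_of_fix fun a ha => hρ a (.inr ha)] at h2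
  have hiso : PairIso I P (A ∪ C ∪ Q) σ := by
    have hσQ : σ '' Q = Q := image_eq_self_of_fix fun x hx => hσ x (.inr hx)
    refine ⟨Q, Set.subset_union_right, hQP, by rwa [hσQ], hI.union_left hi, ?_⟩
    rw [hσQ, Set.union_assoc, Set.image_union, image_eq_self_of_fix hσ]
    refine hI.union_of (hI.union_left (hI.mono_left Set.subset_union_right hi)) ?_
    rw [Set.union_eq_right.2 (Set.subset_union_right : Q ⊆ C ∪ Q)]
    exact hI.mono_right Set.subset_union_left h1
  refine ⟨σ '' A, ⟨σ, ?_, fun c hc => hσ c (.inl hc), rfl⟩, ?_⟩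
  · have h2 := h.isElementaryOn_of_pairIso hom hκ hiso
    exact fun n φ x hx => h2 n φ x fun i => .inl (hx i)
  · refine hI.mono_right ?_ (hI.base_mono (D := P ∪ (B ∪ (C ∪ Q)))
      (Set.union_subset_union_right C hQP) ?_ h1)
    · exact Set.subset_union_left.trans Set.subset_union_right
    · rintro x (hx | hx)
      · exact .inr (.inr (.inl hx))
      · exact .inl hx

end LovelyUnderAut

end SmallExtension

/-! ### Independence over the predicate -/

section IndependenceOverP

variable {L : FirstOrder.Language.{u, v}} {M : Type w} [L.Structure M]
  {I : Set M → Set M → Set M → Prop} {ν μ κbar : Cardinal.{w}} {P A B C : Set M}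

namespace GlobalIndependence

variable (hI : GlobalIndependence L I ν)
include hI

/-- Restricting `A`, `B`, `C` to small sets and extending again gives back independence over
`C ∪ P`, although `P` is not small. -/
theorem extInd_union_iff (h0 : ℵ₀ < κbar) (hν : ν < κbar) :
    ExtInd κbar (fun A C B => I A (C ∪ P) B) A C B ↔ I A (C ∪ P) B := by
  constructor
  · intro h
    refine hI.of_finite fun F hF hFfin => hI.of_finite_right fun F' hF' hFfin' => ?_
    obtain ⟨G, hG, hGν, hb⟩ := hI.local_base (hFfin.union hFfin') (C ∪ P)
    obtain ⟨C', hGC', hC'C, -, hi⟩ := h F hF (G ∩ C) Set.inter_subset_right F' hF'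
      (mk_lt_of_finite h0.le hFfin)
      (mk_lt_of_subset Set.inter_subset_left (hGν.trans hν)) (mk_lt_of_finite h0.le hFfin')
    have hGC'P : G ⊆ C' ∪ P := fun x hx => (hG hx).imp (fun hC => hGC' ⟨hx, hC⟩) id
    have hC'P : C' ∪ P ⊆ C ∪ P := Set.union_subset_union_left P hC'C
    -- `F` and `F'` together are independent from `C ∪ P` over `C' ∪ P`
    have h1 : I F (F' ∪ (C' ∪ P)) (C ∪ P) := by
      refine hI.symm (hI.mono_right Set.subset_union_left (hI.base_up (B := F ∪ F')
        Set.subset_union_right ?_ (hI.symm (hI.base_mono hGC'P hC'P hb))))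
      exact Set.union_subset_union_left _ Set.subset_union_right
    have h2 := hI.trans Set.subset_union_right Set.subset_union_right (hI.union_right hi)
      (hI.union_right h1)
    refine hI.mono_right ?_ (hI.base_mono hC'P Set.subset_union_left h2)
    exact Set.subset_union_left.trans Set.subset_union_right
  · intro h X hX Y hY Z hZ hXs hYs hZs
    obtain ⟨G, hG, hGs, hb⟩ := hI.exists_base h0 hν hXs (C ∪ P)
    refine ⟨Y ∪ G ∩ C, Set.subset_union_left, Set.union_subset hY Set.inter_subset_right,
      mk_union_lt h0.le hYs (mk_lt_of_subset Set.inter_subset_left hGs), ?_⟩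
    have h1 := hI.trans hG Set.subset_union_right hb (hI.union_right (hI.mono hX hZ h))
    refine hI.mono_right Set.subset_union_left (hI.base_mono ?_ ?_ h1)
    · exact fun x hx => (hG hx).imp (fun hC => .inr ⟨hx, hC⟩) id
    · refine Set.union_subset (Set.union_subset ?_ ?_) ?_
      · exact hY.trans (Set.subset_union_left.trans Set.subset_union_right)
      · exact Set.inter_subset_right.trans (Set.subset_union_left.trans Set.subset_union_right)
      · exact Set.subset_union_right.trans Set.subset_union_right

/-- Local character, with any bound `μ`, passes to independence over `P`: a base of `A` in
`C ∪ P₀`, where `P₀` is a small base of `A ∪ C` in `P`, is intersected with `C`. -/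
theorem local_character_union (h0 : ℵ₀ < κbar) (hν : ν < κbar)
    (h : ∀ C : Set M, #C < κbar → ∃ C₀ ⊆ C, #C₀ < μ ∧ I A C₀ C) (hA : #A < κbar)
    (hC : #C < κbar) : ∃ C₀ ⊆ C, #C₀ < μ ∧ I A (C₀ ∪ P) C := by
  obtain ⟨P₀, hP₀P, hP₀, hb⟩ := hI.exists_base h0 hν (mk_union_lt h0.le hA hC) P
  obtain ⟨D, hD, hDμ, hi⟩ := h (C ∪ P₀) (mk_union_lt h0.le hC hP₀)
  refine ⟨D ∩ C, Set.inter_subset_right, mk_lt_of_subset Set.inter_subset_left hDμ, ?_⟩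
  have h1 : I A (C ∪ P₀) P := by
    refine hI.symm (hI.mono_right Set.subset_union_left (hI.base_up (B := A ∪ C)
      Set.subset_union_right ?_ (hI.symm hb)))
    exact Set.union_subset_union_left _ Set.subset_union_right
  have hsub : D ∩ C ∪ P₀ ⊆ C ∪ P₀ := Set.union_subset_union_left _ Set.inter_subset_right
  have h2 : I A (D ∩ C ∪ P₀) (C ∪ P₀) :=
    hI.base_mono (fun x hx => (hD hx).imp (fun hC => ⟨hx, hC⟩) id) hsub hi
  have h3 := hI.trans hsub Set.subset_union_right h2 (hI.union_right h1)
  refine hI.mono_right ?_ (hI.base_mono (Set.union_subset_union_right _ hP₀P) ?_ h3)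
  · exact Set.subset_union_left.trans Set.subset_union_right
  · refine Set.union_subset ?_ Set.subset_union_left
    exact Set.inter_subset_right.trans (Set.subset_union_left.trans Set.subset_union_right)

/-- Conversely, local character over `P` for the conjugates of `A` gives local character for `A`,
since `A ∪ C` has a conjugate that is independent from `P` over the empty set. -/
theorem local_character_of_union (σ : M ≃[L] M) (hσ : I (σ '' (A ∪ C)) ∅ P)
    (h : ∃ C₀ ⊆ σ '' C, #C₀ < μ ∧ I (σ '' A) (C₀ ∪ P) (σ '' C)) :
    ∃ C₀ ⊆ C, #C₀ < μ ∧ I A C₀ C := by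
  obtain ⟨C₀, hC₀, hC₀μ, hi⟩ := h
  refine ⟨σ.symm '' C₀, ?_, Cardinal.mk_image_le.trans_lt hC₀μ, ?_⟩
  · rw [← symm_image_image σ C]
    exact Set.image_mono hC₀
  rw [Set.image_union] at hσ
  have h1 : I (σ '' A) C₀ P := by
    refine hI.symm (hI.mono_right Set.subset_union_left (hI.base_up (Set.empty_subset C₀) ?_
      (hI.symm hσ)))
    exact hC₀.trans (Set.subset_union_right.trans Set.subset_union_left)
  have h2 : I (σ '' A) C₀ (σ '' C) := by
    refine hI.mono_right Set.subset_union_left (hI.trans Set.subset_union_right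
      Set.subset_union_right (hI.union_right h1) (hI.union_right ?_))
    rwa [Set.union_comm]
  have h3 := hI.invariance σ.symm h2
  rwa [symm_image_image, symm_image_image] at h3

end GlobalIndependence

/-- Property (*) passes to independence over `P`: the parameters that lie in `P` but not in `C` are
replaced by existential quantifiers over `P`. -/
theorem PropertyStar.indP {ind : Set M → Set M → Set M → Prop}
    (hext : ∀ A C B : Set M, ExtInd κbar (indP κbar ind P) A C B ↔ ExtInd κbar ind A (C ∪ P) B)
    (h : PropertyStar κbar ind L) :
    letI := pairStructure L P
    PropertyStar κbar (Lovely.indP κbar ind P) (pairLanguage L) := by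
  classical
  let := pairStructure L P
  intro k m a b C hn
  rw [hext] at hn
  obtain ⟨l, c, φ, hc, hφ, himp⟩ := h k m a b (C ∪ P) hn
  let e := Fintype.equivFin {i // c i ∈ C}
  -- the variables of `φ` for parameters outside `C` become bound variables
  let g : Fin k ⊕ Fin m ⊕ Fin l →
      (Fin k ⊕ Fin m ⊕ Fin (Fintype.card {i // c i ∈ C})) ⊕ {i // c i ∉ C} :=
    Sum.elim (Sum.inl ∘ Sum.inl) (Sum.elim (Sum.inl ∘ Sum.inr ∘ Sum.inl)
      fun i => if hi : c i ∈ C then .inl (.inr (.inr (e ⟨i, hi⟩))) else .inr ⟨i, hi⟩)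
  let ψ : (pairLanguage L).Formula (Fin k ⊕ Fin m ⊕ Fin (Fintype.card {i // c i ∈ C})) :=
    Formula.iExs {i // c i ∉ C}
      (liftFormula (φ.relabel g) ⊓ Formula.iInf fun i => memFormula L (Sum.inr i))
  have hψ : ∀ v, ψ.Realize v ↔ ∃ w : {i // c i ∉ C} → M,
      φ.Realize (Sum.elim v w ∘ g) ∧ ∀ i, w i ∈ P := by
    intro v
    simp only [ψ, Formula.realize_iExs, Formula.realize_inf, Formula.realize_iInf]
    refine exists_congr fun w => and_congr ?_ (forall_congr' fun i => realize_memFormula _ _)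
    rw [← Formula.realize_relabel]
    exact realize_liftFormula (P := P) (φ.relabel g) _
  have hg : ∀ (x : Fin k → M) (z : Fin (Fintype.card {i // c i ∈ C}) → M) (w : {i // c i ∉ C} → M),
      Sum.elim (Sum.elim x (Sum.elim b z)) w ∘ g = Sum.elim x (Sum.elim b fun i =>
        if hi : c i ∈ C then z (e ⟨i, hi⟩) else w ⟨i, hi⟩) := by
    intro x z w
    funext i
    rcases i with i | i | i
    · rfl
    · rfl
    · by_cases hi : c i ∈ C <;> simp [g, hi]
  refine ⟨_, fun j => c (e.symm j), ψ, fun j => (e.symm j).2, ?_, ?_⟩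
  · refine (hψ _).2 ⟨fun i => c i, ?_, fun i => (hc i).resolve_left i.2⟩
    rw [hg]
    simpa using hφ
  · intro a' c' hc' hreal
    obtain ⟨w, hw, hwP⟩ := (hψ _).1 hreal
    rw [hg] at hw
    rw [hext]
    refine himp a' _ (fun i => ?_) hw
    by_cases hi : c i ∈ C
    · simpa [hi] using Or.inl (hc' _)
    · simpa [hi] using Or.inr (hwP _)

end IndependenceOverP

section Monster

variable {L : FirstOrder.Language.{u, v}} {M : Type w} [L.Structure M]
  {ind : Set M → Set M → Set M → Prop} {κ κbar : Cardinal.{w}} {P A B C : Set M}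

/-- The pair `⟨M, P⟩` is isomorphic to the corresponding pair on the improper substructure of
`M`. -/
theorem nonempty_equiv_top (P : Set M) :
    letI := pairStructure L P
    letI := subpairStructure (⊤ : L.ElementarySubstructure M) P
    Nonempty (M ≃[pairLanguage L] (⊤ : L.ElementarySubstructure M)) := by
  let := pairStructure L P
  let := subpairStructure (⊤ : L.ElementarySubstructure M) P
  refine ⟨⟨⟨fun x => ⟨x, trivial⟩, Subtype.val, fun _ => rfl, fun _ => rfl⟩, ?_, ?_⟩⟩
  · rintro n (f | f) x
    · rfl
    · exact f.elim
  · rintro n (R | R) x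
    · exact Iff.rfl
    · cases R
      exact Iff.rfl

/-- If loveliness is first-order, then a monster model of the theory of lovely pairs is lovely. -/
theorem LovelinessIsFirstOrder.isLovely (hfo : LovelinessIsFirstOrder (L := L) κbar κ ind)
    (hP : letI := pairStructure L P
      IsMonsterModel M (lovelyTheory (L := L) κbar κ ind) κbar) :
    IsLovely κbar κ ind (⊤ : L.ElementarySubstructure M) P := by
  obtain ⟨lam, hlam, h⟩ := hfo
  obtain ⟨e⟩ := nonempty_equiv_top (L := L) P
  let := pairStructure L P
  let := subpairStructure (⊤ : L.ElementarySubstructure M) P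
  refine h ⊤ P (fun _ _ => trivial) ?_ ?_
  · have := hP.model
    exact StrongHomClass.theory_model e
  · refine IsSaturated.of_equiv (fun A hA => hP.saturated A (hA.trans hlam)) e

theorem IsLovely.lovelyUnderAut (h : IsLovely κbar κ ind (⊤ : L.ElementarySubstructure M) P)
    (hind : IsIndependenceRelation κbar ind L) (hom : IsStronglyHomogeneous L M κbar)
    (h0 : ℵ₀ ≤ κbar) (hκ : κ < κbar) (hν : kappaZero κbar ind < κ) :
    LovelyUnderAut L (ExtInd κbar ind) (kappaZero κbar ind) κ P where
  global := hind.globalIndependence h0 (hν.trans hκ)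
  infinite := (hind.kappaZero_spec h0).1.aleph0_le
  lt := hν
  density A hA b hb := by
    have hb₁ := mk_lt_of_finite h0 (Set.finite_singleton b)
    have hA' := hA.trans hκ
    rw [hind.extInd_iff hb₁ hA' (mk_lt_of_subset Set.inter_subset_right hA')] at hb
    obtain ⟨b', hb', hs⟩ := h.density A (fun _ _ => trivial) hA b hb
    obtain ⟨σ, hσ, hσb⟩ := hs.exists_aut hom h0 hb₁ hA'
    rw [Set.image_singleton, Set.singleton_eq_singleton_iff] at hσb
    exact ⟨σ, hσ, hσb ▸ hb'⟩
  extension A hA b := by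
    have hb₁ := mk_lt_of_finite h0 (Set.finite_singleton b)
    obtain ⟨b', -, hs, hi⟩ := h.extension A (fun _ _ => trivial) hA b
    obtain ⟨σ, hσ, hσb⟩ := hs.exists_aut hom h0 hb₁ (hA.trans hκ)
    rw [Set.image_singleton, Set.singleton_eq_singleton_iff] at hσb
    exact ⟨σ, hσ, hσb ▸ hi⟩

end Monster

end Lovely

theorem mainTheorem8 {L : FirstOrder.Language.{u, v}} {M : Type w} [L.Structure M]
    (T : L.Theory) (hT : T.IsComplete) (κbar : Cardinal.{w})
    (hM : Lovely.IsMonsterModel M T κbar)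
    (ind : Set M → Set M → Set M → Prop)
    (hind : Lovely.IsIndependenceRelation κbar ind L)
    (κ : Cardinal.{w}) (hκ : κ < κbar) (hκ₀ : Lovely.kappaZero κbar ind < κ)
    (hκT : Lovely.CardTheoryLT L κ)
    (hfo : Lovely.LovelinessIsFirstOrder (L := L) κbar κ ind)
    (P : Set M)
    (hP : letI := Lovely.pairStructure L P
      Lovely.IsMonsterModel M (Lovely.lovelyTheory (L := L) κbar κ ind) κbar) :
    letI := Lovely.pairStructure L P
    Lovely.IsIndependenceRelation κbar (Lovely.indP κbar ind P) (Lovely.pairLanguage L) ∧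
    (∀ A C B : Set M, Lovely.ExtInd κbar (Lovely.indP κbar ind P) A C B ↔
      Lovely.ExtInd κbar ind A (C ∪ P) B) ∧
    (∀ κ₀ : Cardinal.{w}, Lovely.LocalCharacter κbar (Lovely.indP κbar ind P) κ₀ ↔
      Lovely.LocalCharacter κbar ind κ₀) ∧
    Lovely.kappaZero κbar (Lovely.indP κbar ind P) = Lovely.kappaZero κbar ind ∧
    (∀ X : Set M, Lovely.closureOp κbar (Lovely.indP κbar ind P) X =
      Lovely.closureOp κbar ind (X ∪ P)) ∧
    Lovely.closureOp κbar (Lovely.indP κbar ind P) ∅ = P ∧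
    (Lovely.PropertyStar κbar ind L →
      Lovely.PropertyStar κbar (Lovely.indP κbar ind P) (Lovely.pairLanguage L)) := by
  have h0 : ℵ₀ < κbar := hM.card_lt.1
  have hν : Lovely.kappaZero κbar ind < κbar := hκ₀.trans hκ
  have hI := hind.globalIndependence h0.le hν
  have hlov := (hfo.isLovely hP).lovelyUnderAut hind hM.homogeneous h0.le hκ hκ₀
  have haut : ∀ A C B : Set M, #A < κbar → #C < κbar → #B < κbar →
      ∃ σ : M ≃[L] M, (∀ c ∈ C, σ c = c) ∧ Lovely.ExtInd κbar ind (σ '' A) C B := by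
    intro A C B hA hC hB
    obtain ⟨σ, hσ, h⟩ := hind.exists_aut hM.homogeneous h0.le hA hB hC
    exact ⟨σ, hσ, (hind.extInd_iff (Lovely.mk_image_lt σ hA) hB hC).2 h⟩
  have hext : ∀ A C B : Set M, Lovely.ExtInd κbar (Lovely.indP κbar ind P) A C B ↔
      Lovely.ExtInd κbar ind A (C ∪ P) B := fun A C B => hI.extInd_union_iff h0 hν
  have hcl : ∀ X : Set M, Lovely.closureOp κbar (Lovely.indP κbar ind P) X =
      Lovely.closureOp κbar ind (X ∪ P) := fun X => Set.ext fun c => hext _ _ _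
  -- local character passes in both directions with any bound `μ`; in the second one, from the
  -- conjugates of `A` to `A`
  have hlc : ∀ (μ : Cardinal.{w}) (A C : Set M), #A < κbar → #C < κbar →
      (∀ C' : Set M, #C' < κbar → ∃ C₀ ⊆ C', #C₀ < μ ∧ ind A C₀ C') →
      ∃ C₀ ⊆ C, #C₀ < μ ∧ Lovely.indP κbar ind P A C₀ C := by
    intro μ A C hA hC h
    refine hI.local_character_union h0 hν (fun C' hC' => ?_) hA hC
    obtain ⟨C₀, hC₀, hlt, hi⟩ := h C' hC'
    exact ⟨C₀, hC₀, hlt, (hind.extInd_iff hA hC' (Lovely.mk_lt_of_subset hC₀ hC')).2 hi⟩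
  have hlc' : ∀ (μ : Cardinal.{w}) (A C : Set M), #A < κbar → #C < κbar →
      (∀ σ : M ≃[L] M, ∃ C₀ ⊆ σ '' C, #C₀ < μ ∧ Lovely.indP κbar ind P (σ '' A) C₀ (σ '' C)) →
      ∃ C₀ ⊆ C, #C₀ < μ ∧ ind A C₀ C := by
    intro μ A C hA hC h
    obtain ⟨σ, -, hσ⟩ := hlov.extension_set hM.homogeneous hκ.le hP haut (A := ∅)
      (Lovely.mk_lt_of_finite h0.le Set.finite_empty) (Lovely.mk_union_lt h0.le hA hC)
    obtain ⟨C₀, hC₀, hlt, hi⟩ := hI.local_character_of_union σ hσ (h σ)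
    exact ⟨C₀, hC₀, hlt, (hind.extInd_iff hA hC (Lovely.mk_lt_of_subset hC₀ hC)).1 hi⟩
  have hLC : ∀ κ₀ : Cardinal.{w}, Lovely.LocalCharacter κbar (Lovely.indP κbar ind P) κ₀ ↔
      Lovely.LocalCharacter κbar ind κ₀ := by
    refine fun κ₀ => ⟨fun h A C hA hC => hlc' _ A C hA hC fun σ => ?_,
      fun h A C hA hC => hlc _ A C hA hC fun C' hC' => h A C' hA hC'⟩
    have := h (σ '' A) (σ '' C) (Lovely.mk_image_lt σ hA) (Lovely.mk_image_lt σ hC)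
    rwa [Cardinal.mk_image_eq σ.injective] at this
  refine ⟨?_, hext, hLC, ?_, hcl, ?_, fun h => h.indP hext⟩
  · let := Lovely.pairStructure L P
    refine ⟨?_, fun A B C _ _ _ h => ?_, fun A B C _ _ _ h => hI.symm h, ?_, ?_, ?_, ?_⟩
    · intro A B C _ _ _ σ h
      obtain ⟨ρ, hρσ, hρP⟩ := Lovely.exists_reduct_aut (P := P) σ
      have h1 := hI.invariance ρ h
      rw [Set.image_union, hρP, Set.image_congr fun a _ => hρσ a,
        Set.image_congr fun a _ => hρσ a, Set.image_congr fun a _ => hρσ a] at h1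
      exact h1
    · exact hI.mono_left (Set.union_subset_union_right _ Set.subset_union_left) (hI.union_left h)
    · intro A B C D _ _ _ _ hBC hCD
      have hBC' := Set.union_subset_union_left P hBC
      have hCD' := Set.union_subset_union_left P hCD
      constructor
      · intro h
        have h1 := hI.union_right h
        have h2 : D ∪ P ⊆ D ∪ (B ∪ P) :=
          Set.union_subset_union_right _ Set.subset_union_right
        exact ⟨hI.mono_right hCD h,
          hI.mono_right Set.subset_union_left (hI.base_mono hBC' (hCD'.trans h2) h1)⟩
      · rintro ⟨h1, h2⟩
        have h3 := hI.union_right h1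
        rw [← Set.union_assoc, Set.union_eq_left.2 hBC] at h3
        exact hI.base_down hBC' h3 h2
    · exact fun A B C _ _ _ => ⟨fun h F hF _ => hI.mono_left hF h, hI.of_finite⟩
    · exact fun A B C hA hB hC =>
        hlov.exists_pair_extension hM.homogeneous hκ.le hP haut hA hB hC
    · obtain ⟨κ₀, hκ₀, h⟩ := hind.local_character
      exact ⟨κ₀, hκ₀, (hLC κ₀).2 h⟩
  · refine congrArg sInf (Set.ext fun μ => and_congr_right fun _ => ⟨?_, ?_⟩)
    · intro h A B hA hB
      exact hlc' μ A B (Lovely.mk_lt_of_finite h0.le hA) hB fun σ =>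
        h _ _ (hA.image σ) (Lovely.mk_image_lt σ hB)
    · exact fun h A B hA hB =>
        hlc μ A B (Lovely.mk_lt_of_finite h0.le hA) hB fun C hC => h A C hA hC
  · rw [hcl, Set.empty_union]
    refine Set.ext fun c => ⟨fun hc => hlov.mem_of_self hc, fun hc => ?_⟩
    exact hI.mono_right (by simpa using hc) (hI.self {c} P)
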